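/- \textbf{Setting.} Let $N\ge 2$. In the star network, $N$ independent sources emit real bipartite states: $\rho_i$ is a real symmetric positive semidefinite matrix of trace one on $\mathbb R^{d_i}\otimes\mathbb R^{e_i}$ (arbitrary finite dimensions), whose first part goes to party $A_i$ and whose second part goes to Eve. Each $A_i$ has three two-outcome real POVMs $\{M^{(i)}_{0|x},M^{(i)}_{1|x}\}$, $x=0,1,2$, with observables $A_{i,x}=M^{(i)}_{0|x}-M^{(i)}_{1|x}$, and Eve has one real POVM $\{R_l\}$ on $\bigotimes_i\mathbb R^{e_i}$ with outcomes $l=l_1\dots l_N\in\{0,1\}^N$. Let $\overline P(l)=\mathrm{Tr}[(\mathbb 1\otimes R_l)\bigotimes_i\rho_i]$ and, for an operator $O$ of the external parties, $\langle O\rangle_l=\mathrm{Tr}[(O\otimes R_l)\bigotimes_i\rho_i]/\overline P(l)$. With $\tilde A_{1,0}=(A_{1,0}-A_{1,1})/\sqrt2$ and $\tilde A_{1,1}=(A_{1,0}+A_{1,1})/\sqrt2$ put $$\mathcal I_l=(-1)^{l_1}\Big[(N-1)\Big\langle\tilde A_{1,1}\prod_{i=2}^N A_{i,1}\Big\rangle_l+\sum_{i=2}^N(-1)^{l_i}\big\langle\tilde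 A_{1,0}A_{i,0}\big\rangle_l\Big],$$ $$\mathcal J_N=-\frac{2}{N(N-1)}\Big[\sum_{2\le j_1<j_2\le N}\Big\langle\tilde A_{1,1}A_{j_1,2}A_{j_2,2}\prod_{\substack{i=2\\ i\ne j_1,j_2}}^N A_{i,1}\Big\rangle_{0\dots0}+\sum_{j=2}^N\Big\langle A_{1,2}A_{j,2}\prod_{\substack{i=2\\ i\ne j}}^N A_{i,1}\Big\rangle_{0\dots0}\Big].$$ Let $$\delta_N=16(N-1)+2N(N-1)\Big[\sqrt2+1+\sqrt{\tfrac1{N-1}}\Big],$$ $$f(N)=\Big[8+(N-3)\Big(\sqrt2+1+\sqrt{\tfrac1{N-1}}\Big)\Big]+2\big(\delta_N+\sqrt{2(N-1)}\big)+\frac{N^2}{2}\big(\delta_N+\sqrt{2(N-1)}\big)^2 .$$ \textbf{Theorem.} Suppose that $\mathcal I_l\ge 2(N-1)-\varepsilon_N$ and $|\overline P(l)-1/2^N|\le\varepsilon_N$ for all $l\in\{0,1\}^N$. Then $$\mathcal J_N\le\frac1{N-1}+f(N)\sqrt{2\varepsilon_N}+2^N\varepsilon_N .$$ That is, the maximal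 value $\beta_{\mathrm{RQT}}$ of $\mathcal J_N$ over all such real experiments is at most the right-hand side. In particular $\beta_{\mathrm{RQT}}\le\frac1{N-1}+O(2^N\varepsilon_N)$ in the regime $f(N)^2/4^N=O(\varepsilon_N)$: for every $K$ there is a constant $C$, depending only on $K$, such that for all $N\ge2$ and all $\varepsilon_N$ with $f(N)^2/4^N\le K\varepsilon_N$, one has $\mathcal J_N\le\frac1{N-1}+C\,2^N\varepsilon_N$ under the same hypotheses. -/

import Mathlib

open scoped Kronecker

noncomputable section

/-- The tensor product `⨂ᵢ Oᵢ` of one square matrix per party. -/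
def localTensor {N : ℕ} {d : Fin N → ℕ} (O : ∀ i, Matrix (Fin (d i)) (Fin (d i)) ℝ) :
    Matrix (∀ i, Fin (d i)) (∀ i, Fin (d i)) ℝ :=
  Matrix.of fun a a' => ∏ i, O i (a i) (a' i)

/-- The sign `(-1)^b` of a bit `b`. -/
def bitSign (b : Bool) : ℝ := if b then -1 else 1

/-- An experiment in the star network described by real quantum theory.
There are `N` external parties, indexed by `Fin N`, with party `A₁` at index `0`.
The `i`-th source emits a (possibly mixed) real bipartite state `ρ i`, shared between the party
`Aᵢ` (local dimension `dA i`) and Eve (who gets a system of dimension `dE i`). Every party has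
three two-outcome measurements (real POVMs) and Eve has one real `2^N`-outcome POVM
on all of her systems, whose outcomes are bit strings `l = l₁ … l_N`. Dimensions are arbitrary. -/
structure RealStarNetwork (N : ℕ) where
  dA : Fin N → ℕ
  dE : Fin N → ℕ
  /-- the states of the sources -/
  ρ : ∀ i, Matrix (Fin (dA i) × Fin (dE i)) (Fin (dA i) × Fin (dE i)) ℝ
  ρ_pos : ∀ i, (ρ i).PosSemidef
  ρ_trace : ∀ i, (ρ i).trace = 1
  /-- `M i x a` is the effect of outcome `a` of measurement `x` of the party `i` -/
  M : ∀ i, Fin 3 → Fin 2 → Matrix (Fin (dA i)) (Fin (dA i)) ℝ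
  M_pos : ∀ i x a, (M i x a).PosSemidef
  M_sum : ∀ i x, ∑ a, M i x a = 1
  /-- Eve's effects -/
  R : (Fin N → Bool) → Matrix (∀ i, Fin (dE i)) (∀ i, Fin (dE i)) ℝ
  R_pos : ∀ l, (R l).PosSemidef
  R_sum : ∑ l, R l = 1

namespace RealStarNetwork

variable {N : ℕ} (S : RealStarNetwork N)

/-- The joint state of all systems: the tensor product of the states of the sources, with the
factors ordered as (all external parties, all of Eve's systems). -/
def jointState :
    Matrix ((∀ i, Fin (S.dA i)) × (∀ i, Fin (S.dE i)))
      ((∀ i, Fin (S.dA i)) × (∀ i, Fin (S.dE i))) ℝ :=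
  Matrix.of fun p q => ∏ i, S.ρ i (p.1 i, p.2 i) (q.1 i, q.2 i)

/-- The unnormalised expectation `Tr[(⨂ᵢ Oᵢ ⊗ R_l) ρ]`. -/
def jointExp (l : Fin N → Bool) (O : ∀ i, Matrix (Fin (S.dA i)) (Fin (S.dA i)) ℝ) : ℝ :=
  ((localTensor O ⊗ₖ S.R l) * S.jointState).trace

/-- The probability that Eve obtains the outcome `l`. -/
def outcomeProb (l : Fin N → Bool) : ℝ := S.jointExp l fun _ => 1

/-- The expectation of `⨂ᵢ Oᵢ` in the state of the external parties
conditioned on Eve's outcome `l`. -/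
def condExp (l : Fin N → Bool) (O : ∀ i, Matrix (Fin (S.dA i)) (Fin (S.dA i)) ℝ) : ℝ :=
  S.jointExp l O / S.outcomeProb l

/-- The observable `A_{i,x} = M_{0|x} - M_{1|x}`. -/
def obs (i : Fin N) (x : Fin 3) : Matrix (Fin (S.dA i)) (Fin (S.dA i)) ℝ :=
  S.M i x 0 - S.M i x 1

/-- `(A_{i,0} - A_{i,1}) / √2` (used for the first party). -/
def tilde0 (i : Fin N) : Matrix (Fin (S.dA i)) (Fin (S.dA i)) ℝ :=
  (√2)⁻¹ • (S.obs i 0 - S.obs i 1)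

/-- `(A_{i,0} + A_{i,1}) / √2` (used for the first party). -/
def tilde1 (i : Fin N) : Matrix (Fin (S.dA i)) (Fin (S.dA i)) ℝ :=
  (√2)⁻¹ • (S.obs i 0 + S.obs i 1)

/-- The Bell functional `I_l`, evaluated on the state conditioned on Eve's outcome `l`. -/
def bellI [NeZero N] (l : Fin N → Bool) : ℝ :=
  bitSign (l 0) *
    (((N : ℝ) - 1) *
        S.condExp l (fun i => if i = 0 then S.tilde1 i else S.obs i 1)
      + ∑ j : Fin N with j ≠ 0, bitSign (l j) *
        S.condExp l (fun i => if i = 0 then S.tilde0 i else if i = j then S.obs i 0 else 1))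

/-- The Mermin-type functional `J_N`, evaluated on the state conditioned on Eve's
outcome `0 … 0`. -/
def merminJ [NeZero N] : ℝ :=
  -(2 / ((N : ℝ) * ((N : ℝ) - 1))) *
    ((∑ j₁ : Fin N with j₁ ≠ 0, ∑ j₂ : Fin N with j₁ < j₂,
        S.condExp (fun _ => false) (fun i =>
          if i = 0 then S.tilde1 i else if i = j₁ ∨ i = j₂ then S.obs i 2 else S.obs i 1))
      + ∑ j : Fin N with j ≠ 0,
        S.condExp (fun _ => false) (fun i =>
          if i = 0 ∨ i = j then S.obs i 2 else S.obs i 1))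

/-- The noisy operational condition: every Bell value `I_l` is `ε`-close to its quantum bound
`2(N-1)`, and every outcome probability of Eve is `ε`-close to `1/2^N`. -/
def NearlyOptimal [NeZero N] (ε : ℝ) : Prop :=
  (∀ l, 2 * ((N : ℝ) - 1) - ε ≤ S.bellI l) ∧ (∀ l, |S.outcomeProb l - 1 / 2 ^ N| ≤ ε)

end RealStarNetwork

/-- The values of `J_N` attainable in real quantum theory under the noisy
operational condition with error `ε`. -/
def rqtValues (N : ℕ) [NeZero N] (ε : ℝ) : Set ℝ :=
  {v | ∃ S : RealStarNetwork N, S.NearlyOptimal ε ∧ S.merminJ = v}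

/-- `δ_N = 16(N-1) + 2N(N-1)[√2 + 1 + √(1/(N-1))]`. -/
def deltaErr (N : ℕ) : ℝ :=
  16 * ((N : ℝ) - 1) +
    2 * (N : ℝ) * ((N : ℝ) - 1) * (√2 + 1 + √(1 / ((N : ℝ) - 1)))

/-- `f(N) = [8 + (N-3)(√2 + 1 + √(1/(N-1)))] + 2(δ_N + √(2(N-1))) + (N²/2)(δ_N + √(2(N-1)))²`. -/
def fErr (N : ℕ) : ℝ :=
  (8 + ((N : ℝ) - 3) * (√2 + 1 + √(1 / ((N : ℝ) - 1))))
    + 2 * (deltaErr N + √(2 * ((N : ℝ) - 1)))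
    + (N : ℝ) ^ 2 / 2 * (deltaErr N + √(2 * ((N : ℝ) - 1))) ^ 2

end

/-! Write `η = √(2ε)`, let `φ` be the state of the external parties conditioned on the outcome
`0…0`, `P` its probability, and `ρ` the state of these parties with Eve ignored. Independence of the
sources makes `ρ` a product state, and `ρ` is the sum of all unnormalised conditional states, so `P
φ ≤ ρ` on positive operators.

A nearly maximal Bell value is a sum of squares with small expectation. Hence in the GNS seminorm of
each conditional state every party has observables `X`, `Z` satisfying the GHZ stabilizer relations
up to `O(η)` (`isNearGHZ_of_bell`). Up to signs depending on Eve's outcome, `X` and `Z` have the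
moments of Pauli matrices in the maximally mixed state. The bounds on these moments do not see the
signs, so they pass to the marginals of `ρ` (`isApproxPauli_marginal`).

Let `Y` be the third observable. Since `⨂ X ≈ 1` in `φ`, `J_N` is essentially `-∑_{i≠j} φ(dᵢ
dⱼ)/(N(N-1))` with `dₖ = Yₖ Xₖ`. Split `dₖ` into a symmetric and a skew part `Kₖ`. The symmetric
parts contribute at most `N` because `φ((∑ wᵢ)²) ≥ 0`, and what remains is bounded by `φ(G)`, where
`G = N - ∑_{i≠j} Kᵢ Kⱼ` is itself a sum of squares.

Let `S` be the approximate GHZ projection built from `X` and `Z`. It nearly fixes `φ`, so `P φ(G) ≈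
P φ(S⋆GS) ≤ ρ(S⋆GS)`. The product state gives `ρ(S⋆S) ≈ 2^{-N}`. The terms `ρ(S⋆KᵢKⱼS)` nearly
vanish: `S` is half a sum of four product operators, the off-diagonal pairs of these are nearly
orthogonal at every other site, and a diagonal pair contains the expectation of a skew element in a
real state, which is zero. This is the decisive use of real numbers (`ghzFactor_skew`,
`abs_product_conj_skew_le`). So `2^N P φ(G) ≲ N` and `J_N ≲ 1/(N-1)` (`mermin_bound`); the deviation
of `2^N P` from `1` costs `2^N ε`. -/

set_option linter.unusedSectionVars false

/-! ### States, GNS seminorm and sums of squares in real `*`-algebras -/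

section PositiveFunctional

variable {A : Type*} [Ring A] [Algebra ℝ A] [StarRing A] [StarModule ℝ A]

/-- A positive real linear functional on a real `*`-algebra, invariant under the involution. -/
structure IsPositiveFunctional (φ : A →ₗ[ℝ] ℝ) : Prop where
  -- Reality enters here: invariance, rather than invariance up to complex conjugation, makes every
  -- skew element have expectation zero.
  map_star : ∀ x, φ (star x) = φ x
  nonneg : ∀ x, 0 ≤ φ (star x * x)

/-- A state: a normalised positive functional. -/
structure IsState (φ : A →ₗ[ℝ] ℝ) : Prop extends IsPositiveFunctional φ where
  map_one : φ 1 = 1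

/-- The GNS seminorm `√φ(x⋆x)`. -/
noncomputable def gnsNorm (φ : A →ₗ[ℝ] ℝ) (x : A) : ℝ := √(φ (star x * x))

theorem gnsNorm_nonneg (φ : A →ₗ[ℝ] ℝ) (x : A) : 0 ≤ gnsNorm φ x := Real.sqrt_nonneg _

namespace IsPositiveFunctional

variable {φ : A →ₗ[ℝ] ℝ} (h : IsPositiveFunctional φ)
include h

theorem gnsNorm_sq (x : A) : gnsNorm φ x ^ 2 = φ (star x * x) := Real.sq_sqrt (h.nonneg x)

theorem star_mul_comm (x y : A) : φ (star x * y) = φ (star y * x) := by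
  rw [← h.map_star (star y * x)]; simp

theorem abs_star_mul_le (x y : A) : |φ (star x * y)| ≤ gnsNorm φ x * gnsNorm φ y := by
  have key : ∀ t : ℝ, 0 ≤ φ (star x * x) * (t * t) + (2 * φ (star x * y)) * t
      + φ (star y * y) := by
    intro t
    have := h.nonneg (t • x + y)
    simp only [star_add, star_smul, star_trivial, add_mul, mul_add, smul_mul_assoc,
      mul_smul_comm, map_add, map_smul, smul_eq_mul] at this
    rw [h.star_mul_comm y x] at this
    linarith
  have hd := discrim_le_zero key
  unfold discrim at hd
  apply abs_le_of_sq_le_sq _ (mul_nonneg (gnsNorm_nonneg _ _) (gnsNorm_nonneg _ _))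
  rw [mul_pow, h.gnsNorm_sq, h.gnsNorm_sq]
  linarith

theorem gnsNorm_add_le (x y : A) : gnsNorm φ (x + y) ≤ gnsNorm φ x + gnsNorm φ y := by
  apply le_of_sq_le_sq _ (add_nonneg (gnsNorm_nonneg _ _) (gnsNorm_nonneg _ _))
  have := (abs_le.1 (h.abs_star_mul_le x y)).2
  rw [h.gnsNorm_sq]
  simp only [star_add, add_mul, mul_add, map_add]
  rw [h.star_mul_comm y x, ← h.gnsNorm_sq, ← h.gnsNorm_sq]
  nlinarith

omit h in
theorem gnsNorm_smul (c : ℝ) (x : A) : gnsNorm φ (c • x) = |c| * gnsNorm φ x := by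
  unfold gnsNorm
  rw [← Real.sqrt_sq_eq_abs, ← Real.sqrt_mul (sq_nonneg c)]
  congr 1
  simp [smul_smul, sq]

omit h in
theorem gnsNorm_neg (x : A) : gnsNorm φ (-x) = gnsNorm φ x := by
  simp [gnsNorm]

omit h in
theorem gnsNorm_sub_comm (x y : A) : gnsNorm φ (x - y) = gnsNorm φ (y - x) := by
  rw [← gnsNorm_neg, neg_sub]

theorem gnsNorm_sub_le (x y : A) : gnsNorm φ (x - y) ≤ gnsNorm φ x + gnsNorm φ y := by
  rw [sub_eq_add_neg, ← gnsNorm_neg (φ := φ) y]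
  exact h.gnsNorm_add_le _ _

theorem gnsNorm_sub_le_sub (x y z : A) :
    gnsNorm φ (x - z) ≤ gnsNorm φ (x - y) + gnsNorm φ (y - z) := by
  have := h.gnsNorm_add_le (x - y) (y - z)
  simpa using this

end IsPositiveFunctional

variable (A) in
/-- The cone of sums of hermitian squares. -/
def sqCone : AddSubmonoid A := AddSubmonoid.closure (Set.range fun r : A => star r * r)

theorem star_mul_self_mem_sqCone (r : A) : star r * r ∈ sqCone A :=
  AddSubmonoid.subset_closure ⟨r, rfl⟩

theorem conj_mem_sqCone {x : A} (hx : x ∈ sqCone A) (y : A) : star y * x * y ∈ sqCone A := by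
  induction hx using AddSubmonoid.closure_induction with
  | mem x hx =>
    obtain ⟨r, rfl⟩ := hx
    convert star_mul_self_mem_sqCone (r * y) using 1
    simp [mul_assoc]
  | zero => simp
  | add a b _ _ ha hb => simpa [mul_add, add_mul] using add_mem ha hb

theorem smul_mem_sqCone {x : A} (hx : x ∈ sqCone A) {c : ℝ} (hc : 0 ≤ c) : c • x ∈ sqCone A := by
  have := conj_mem_sqCone hx (algebraMap ℝ A (√c))
  convert this using 1
  rw [← algebraMap_star_comm, star_trivial, mul_assoc, ← Algebra.commutes, ← mul_assoc, ← map_mul,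
    Real.mul_self_sqrt hc, Algebra.smul_def]

theorem IsPositiveFunctional.nonneg_of_mem {φ : A →ₗ[ℝ] ℝ} (h : IsPositiveFunctional φ) {x : A}
    (hx : x ∈ sqCone A) : 0 ≤ φ x := by
  induction hx using AddSubmonoid.closure_induction with
  | mem x hx => obtain ⟨r, rfl⟩ := hx; exact h.nonneg r
  | zero => simp
  | add a b _ _ ha hb => rw [map_add]; exact add_nonneg ha hb

theorem map_mem_sqCone {B : Type*} [Ring B] [Algebra ℝ B] [StarRing B] [StarModule ℝ B]
    (f : A →⋆ₐ[ℝ] B) {x : A} (hx : x ∈ sqCone A) : f x ∈ sqCone B := by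
  induction hx using AddSubmonoid.closure_induction with
  | mem x hx =>
    obtain ⟨r, rfl⟩ := hx
    simpa only [map_mul, map_star] using star_mul_self_mem_sqCone (f r)
  | zero => simp
  | add a b _ _ ha hb => rw [map_add]; exact add_mem ha hb

/-- Algebraic contractions: `1 - x⋆x` is a sum of hermitian squares. -/
def IsContraction (x : A) : Prop := 1 - star x * x ∈ sqCone A

namespace IsContraction

theorem one : IsContraction (1 : A) := by simp [IsContraction, (sqCone A).zero_mem]

theorem mul {x y : A} (hx : IsContraction x) (hy : IsContraction y) : IsContraction (x * y) := by
  have := add_mem (conj_mem_sqCone hx y) hy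
  unfold IsContraction
  convert this using 1
  simp only [star_mul]
  noncomm_ring

theorem neg {x : A} (hx : IsContraction x) : IsContraction (-x) := by
  simpa [IsContraction] using hx

/-- Parallelogram identity: `1 - |(x+y)/2|²` is the mean of `1 - |x|²` and `1 - |y|²` plus
`|x-y|²/4`. -/
theorem half_add {x y : A} (hx : IsContraction x) (hy : IsContraction y) :
    IsContraction ((1 / 2 : ℝ) • (x + y)) := by
  have h1 := smul_mem_sqCone (add_mem hx hy) (by norm_num : (0 : ℝ) ≤ 1 / 2)
  have h2 := smul_mem_sqCone (star_mul_self_mem_sqCone (x - y)) (by norm_num : (0 : ℝ) ≤ 1 / 4)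
  unfold IsContraction
  convert add_mem h1 h2 using 1
  simp only [star_add, star_sub, star_smul, star_trivial, add_mul, mul_add, sub_mul, mul_sub,
    smul_mul_assoc, mul_smul_comm]
  module

theorem half_sub {x y : A} (hx : IsContraction x) (hy : IsContraction y) :
    IsContraction ((1 / 2 : ℝ) • (x - y)) := by
  rw [sub_eq_add_neg]; exact hx.half_add hy.neg

theorem smul {x : A} (hx : IsContraction x) {c : ℝ} (hc : c ^ 2 ≤ 1) : IsContraction (c • x) := by
  have h1 := smul_mem_sqCone hx (sq_nonneg c)
  have h2 := smul_mem_sqCone (star_mul_self_mem_sqCone (1 : A)) (sub_nonneg.2 hc)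
  unfold IsContraction
  convert add_mem h1 h2 using 1
  simp only [star_smul, star_trivial, star_one, mul_one, smul_mul_assoc, mul_smul_comm]
  module

theorem map {B : Type*} [Ring B] [Algebra ℝ B] [StarRing B] [StarModule ℝ B]
    (f : A →⋆ₐ[ℝ] B) {x : A} (hx : IsContraction x) : IsContraction (f x) := by
  have := map_mem_sqCone f hx
  simpa [IsContraction, map_star] using this

theorem gnsNorm_mul_le {x : A} (hx : IsContraction x) {φ : A →ₗ[ℝ] ℝ}
    (h : IsPositiveFunctional φ) (y : A) : gnsNorm φ (x * y) ≤ gnsNorm φ y := by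
  apply Real.sqrt_le_sqrt
  have := h.nonneg_of_mem (conj_mem_sqCone hx y)
  rw [← sub_nonneg, ← map_sub]
  convert this using 2
  simp only [star_mul]
  noncomm_ring

theorem gnsNorm_le_one {x : A} (hx : IsContraction x) {φ : A →ₗ[ℝ] ℝ}
    (h : IsState φ) : gnsNorm φ x ≤ 1 := by
  have := hx.gnsNorm_mul_le h.toIsPositiveFunctional 1
  simpa [gnsNorm, h.map_one] using this

theorem abs_star_mul_le {x : A} (hx : IsContraction x) {φ : A →ₗ[ℝ] ℝ}
    (h : IsState φ) (y : A) : |φ (star x * y)| ≤ gnsNorm φ y := by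
  refine (h.abs_star_mul_le x y).trans ?_
  have := gnsNorm_nonneg φ y
  have := hx.gnsNorm_le_one h
  nlinarith

theorem abs_apply_le_one {x : A} (hx : IsContraction x) {φ : A →ₗ[ℝ] ℝ}
    (h : IsState φ) : |φ x| ≤ 1 := by
  have := (one (A := A)).abs_star_mul_le h x
  simp only [star_one, one_mul] at this
  exact this.trans (hx.gnsNorm_le_one h)

end IsContraction

/-- Self-adjoint contractions. -/
structure IsObservable (x : A) : Prop where
  star_eq : star x = x
  contr : IsContraction x

namespace IsObservable

theorem one : IsObservable (1 : A) := ⟨star_one A, IsContraction.one⟩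

theorem neg {x : A} (hx : IsObservable x) : IsObservable (-x) :=
  ⟨by simp [hx.star_eq], hx.contr.neg⟩

theorem map {B : Type*} [Ring B] [Algebra ℝ B] [StarRing B] [StarModule ℝ B]
    (f : A →⋆ₐ[ℝ] B) {x : A} (hx : IsObservable x) : IsObservable (f x) :=
  ⟨by rw [← map_star, hx.star_eq], hx.contr.map f⟩

theorem abs_mul_le {x : A} (hx : IsObservable x) {φ : A →ₗ[ℝ] ℝ}
    (h : IsState φ) (y : A) : |φ (x * y)| ≤ gnsNorm φ y := by
  have := hx.contr.abs_star_mul_le h y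
  rwa [hx.star_eq] at this

/-- If `φ(x²)` is close to `1` then `x² ≈ 1` in the GNS seminorm. -/
theorem gnsNorm_sq_sub_one_le {x : A} (hx : IsObservable x) {φ : A →ₗ[ℝ] ℝ}
    (h : IsState φ) {η : ℝ} (hη : 0 ≤ η) (hφ : 1 - φ (x * x) ≤ η ^ 2) :
    gnsNorm φ (x * x - 1) ≤ η := by
  apply le_of_sq_le_sq _ hη
  rw [h.gnsNorm_sq]
  have h1 := h.nonneg_of_mem (conj_mem_sqCone hx.contr x)
  -- The subtracted term `x(1 - x²)x` is a sum of squares, so `φ((x² - 1)²) ≤ 1 - φ(x²)`.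
  have e : star (x * x - 1) * (x * x - 1) = (1 - x * x) - (star x * (1 - star x * x) * x) := by
    simp only [star_sub, star_mul, star_one, hx.star_eq]
    noncomm_ring
  rw [e, map_sub, map_sub, h.map_one]
  linarith

end IsObservable

end PositiveFunctional

/-! ### Approximate stabilizer relations and Pauli moments -/

section ApproximateStabilizers

variable {A : Type*} [Ring A] [Algebra ℝ A] [StarRing A] [StarModule ℝ A]

theorem IsContraction.abs_mul_star_le {p : A} (hp : IsContraction p) {φ : A →ₗ[ℝ] ℝ}
    (h : IsState φ) (q : A) : |φ (star q * p)| ≤ gnsNorm φ q := by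
  rw [h.star_mul_comm]; exact hp.abs_star_mul_le h q

/-- Sum-of-squares analysis of a nearly maximal value of the Bell functional. -/
theorem bell_sum_of_squares {φ : A →ₗ[ℝ] ℝ} (h : IsState φ) {ι : Type*} {s : Finset ι}
    (hs : s.Nonempty) {α₀ α₁ b : A} {ζ : ι → A} (h₀ : IsObservable α₀) (h₁ : IsObservable α₁)
    (hb : IsObservable b) (hζ : ∀ j ∈ s, IsObservable (ζ j))
    {x z : A} (hx : x = (√2)⁻¹ • (α₀ + α₁)) (hz : z = (√2)⁻¹ • (α₀ - α₁)) {η : ℝ} (hη : 0 ≤ η)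
    (hI : 2 * (s.card : ℝ) - η ^ 2 / 2 ≤ s.card * φ (x * b) + ∑ j ∈ s, φ (z * ζ j)) :
    gnsNorm φ (x - b) ≤ η ∧ 1 - φ (α₀ * α₀) ≤ η ^ 2 ∧ 1 - φ (α₁ * α₁) ≤ η ^ 2 ∧
      1 - φ (b * b) ≤ η ^ 2 ∧
      ∀ j ∈ s, gnsNorm φ (z - ζ j) ≤ η ∧ 1 - φ (ζ j * ζ j) ≤ η ^ 2 := by
  have hle : ∀ {y : A}, IsObservable y → 0 ≤ 1 - φ (y * y) := by
    intro y hy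
    have := h.nonneg_of_mem hy.contr
    rwa [map_sub, h.map_one, hy.star_eq] at this
  have hxs : star x = x := by simp [hx, h₀.star_eq, h₁.star_eq]
  have hzs : star z = z := by simp [hz, h₀.star_eq, h₁.star_eq]
  -- The rotation by 45 degrees preserves the sum of squares; no relation between `α₀` and `α₁` is
  -- needed.
  have hxz : φ (x * x) + φ (z * z) = φ (α₀ * α₀) + φ (α₁ * α₁) := by
    rw [← map_add, ← map_add]
    congr 1
    have h2 : (√2)⁻¹ ^ 2 * 2 = (1 : ℝ) := by
      rw [inv_pow, Real.sq_sqrt (by norm_num)]; norm_num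
    simp only [hx, hz, smul_mul_assoc, mul_smul_comm, add_mul, mul_add, sub_mul, mul_sub]
    match_scalars <;> first | linear_combination h2 | ring
  have hsq : ∀ {p q : A}, star p = p → star q = q →
      gnsNorm φ (p - q) ^ 2 = φ (p * p) - 2 * φ (p * q) + φ (q * q) := by
    intro p q hp hq
    have := h.star_mul_comm q p
    rw [hp, hq] at this
    rw [h.gnsNorm_sq, star_sub, hp, hq]
    simp only [sub_mul, mul_sub, map_sub]
    linarith
  have hn : (1 : ℝ) ≤ s.card := by exact_mod_cast hs.card_pos
  -- With `n = s.card`, `4n` minus twice the Bell value equals `n u + ∑ t j` exactly, where `u` is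
  -- defined below. All summands are nonnegative, so each of them is at most `η²`.
  set t : ι → ℝ := fun j => gnsNorm φ (z - ζ j) ^ 2 + (1 - φ (ζ j * ζ j)) with ht
  have ht0 : ∀ j ∈ s, 0 ≤ t j := fun j hj => add_nonneg (sq_nonneg _) (hle (hζ j hj))
  have htsum : ∑ j ∈ s, t j = s.card * (φ (z * z) + 1) - 2 * ∑ j ∈ s, φ (z * ζ j) := by
    rw [Finset.mul_sum, ← nsmul_eq_mul, ← Finset.sum_const, ← Finset.sum_sub_distrib]
    refine Finset.sum_congr rfl fun j hj => ?_
    simp only [ht]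
    rw [hsq hzs (hζ j hj).star_eq]
    ring
  have h0' := hle h₀
  have h1' := hle h₁
  have hb' := hle hb
  have hxb := hsq hxs hb.star_eq
  set u := gnsNorm φ (x - b) ^ 2 + (1 - φ (α₀ * α₀)) + (1 - φ (α₁ * α₁)) + (1 - φ (b * b))
    with hu
  have hu0 : 0 ≤ u := by have := sq_nonneg (gnsNorm φ (x - b)); linarith
  have htot : s.card * u + ∑ j ∈ s, t j ≤ η ^ 2 := by
    rw [htsum, hu, hxb]
    have : φ (z * z) = φ (α₀ * α₀) + φ (α₁ * α₁) - φ (x * x) := by linarith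
    rw [this]
    linarith
  have htp : 0 ≤ ∑ j ∈ s, t j := Finset.sum_nonneg ht0
  have hu1 : u ≤ η ^ 2 := by nlinarith
  have hxb0 := sq_nonneg (gnsNorm φ (x - b))
  refine ⟨le_of_sq_le_sq (by linarith) hη, by linarith, by linarith, by linarith, ?_⟩
  intro j hj
  have h3 : t j ≤ ∑ j ∈ s, t j := Finset.single_le_sum ht0 hj
  have h4 : t j ≤ η ^ 2 := by nlinarith
  have h5 := hle (hζ j hj)
  have h6 := sq_nonneg (gnsNorm φ (z - ζ j))
  simp only [ht] at h4
  exact ⟨le_of_sq_le_sq (by linarith) hη, by linarith⟩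

/-- The polynomial `x(3 - x²)/2`, which maps `[-2, 2]` to `[-1, 1]` and is close to `x` near `±1`. -/
noncomputable def clip (x : A) : A := (3 / 2 : ℝ) • x - (1 / 2 : ℝ) • (x * x * x)

theorem IsObservable.clip {x : A} (hs : star x = x) (hx : IsContraction ((2 / 3 : ℝ) • x)) :
    IsObservable (clip x) := by
  refine ⟨by simp [_root_.clip, hs, mul_assoc], ?_⟩
  have h1 : IsContraction ((1 / 2 : ℝ) • x) := by
    have := hx.smul (c := 3 / 4) (by norm_num)
    rw [smul_smul] at this
    norm_num at this ⊢
    exact this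
  -- The identity behind this is `1 - clip(x)² = (1 - x²)(1 - x²/4)(1 - x²)`.
  have h2 := conj_mem_sqCone h1 (1 - x * x)
  unfold IsContraction
  convert h2 using 1
  simp only [_root_.clip, star_sub, star_smul, star_mul, hs, star_trivial, star_one, sub_mul,
    mul_sub, smul_mul_assoc, mul_smul_comm, one_mul, mul_one, mul_assoc, smul_sub]
  module

theorem clip_neg (x : A) : clip (-x) = -clip x := by
  simp only [clip, neg_mul, mul_neg, neg_neg, smul_neg]; abel

theorem map_clip {B : Type*} [Ring B] [Algebra ℝ B] [StarRing B] [StarModule ℝ B]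
    (f : A →⋆ₐ[ℝ] B) (x : A) : f (clip x) = clip (f x) := by
  simp [clip]

theorem Commute.clip_left {x y : A} (h : Commute x y) : Commute (clip x) y :=
  (h.smul_left _).sub_left (((h.mul_left h).mul_left h).smul_left _)

/-- A self-adjoint `x` that is close to a commuting observable `w` with `w² ≈ 1` squares
approximately to `1`, and is close to its clipped version. -/
theorem clip_approx {φ : A →ₗ[ℝ] ℝ} (h : IsState φ) {x w : A}
    (hs : star x = x) (hx : IsContraction ((2 / 3 : ℝ) • x)) (hw : IsObservable w)
    (hxw : Commute x w) {η : ℝ} (h1 : gnsNorm φ (x - w) ≤ η) (h2 : gnsNorm φ (w * w - 1) ≤ η) :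
    gnsNorm φ (clip x - x) ≤ 3 * η ∧ gnsNorm φ (clip x - w) ≤ 4 * η ∧
      gnsNorm φ (clip x * clip x - 1) ≤ 9 * η := by
  have hη : 0 ≤ η := (gnsNorm_nonneg _ _).trans h1
  have hbd : ∀ y, gnsNorm φ (x * y) ≤ 3 / 2 * gnsNorm φ y := by
    intro y
    have := hx.gnsNorm_mul_le h.toIsPositiveFunctional y
    rw [smul_mul_assoc, IsPositiveFunctional.gnsNorm_smul, abs_of_pos (by norm_num)] at this
    linarith
  have h3 : gnsNorm φ (x * x - 1) ≤ 7 / 2 * η := by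
    -- The GNS seminorm only tolerates contractions on the left of a small element. Commuting `x`
    -- with `w` puts each small factor on the right; the later decompositions use the same device.
    have e : x * x - 1 = x * (x - w) + (w * (x - w) + (w * w - 1)) := by
      simp only [mul_sub, hxw.eq]; abel
    rw [e]
    have a1 := h.gnsNorm_add_le (x * (x - w)) (w * (x - w) + (w * w - 1))
    have a2 := h.gnsNorm_add_le (w * (x - w)) (w * w - 1)
    have a3 := hbd (x - w)
    have a4 := hw.contr.gnsNorm_mul_le h.toIsPositiveFunctional (x - w)
    linarith
  have h4 : gnsNorm φ (clip x - x) ≤ 21 / 8 * η := by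
    have e : clip x - x = (-(1 / 2) : ℝ) • (x * (x * x - 1)) := by
      simp only [clip, mul_sub, mul_one, mul_assoc]; module
    rw [e, IsPositiveFunctional.gnsNorm_smul, abs_of_neg (by norm_num)]
    have := hbd (x * x - 1)
    linarith
  have h5 : gnsNorm φ (clip x - w) ≤ 4 * η := by
    have := h.gnsNorm_sub_le_sub (clip x) x w
    linarith
  refine ⟨by linarith, h5, ?_⟩
  have hc := IsObservable.clip hs hx
  have hcw : Commute (clip x) w := hxw.clip_left
  have e : clip x * clip x - 1 = clip x * (clip x - w) + (w * (clip x - w) + (w * w - 1)) := by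
    simp only [mul_sub, hcw.eq]; abel
  rw [e]
  have a1 := h.gnsNorm_add_le (clip x * (clip x - w)) (w * (clip x - w) + (w * w - 1))
  have a2 := h.gnsNorm_add_le (w * (clip x - w)) (w * w - 1)
  have a3 := hc.contr.gnsNorm_mul_le h.toIsPositiveFunctional (clip x - w)
  have a4 := hw.contr.gnsNorm_mul_le h.toIsPositiveFunctional (clip x - w)
  linarith

/-- The pair `X, Z` has, up to errors of order `η`, the moments of two Pauli matrices in the
maximally mixed state. -/
structure IsApproxPauli (φ : A →ₗ[ℝ] ℝ) (X Z : A) (η : ℝ) : Prop where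
  abs_Z : |φ Z| ≤ 25 * η
  abs_X : |φ X| ≤ 25 * η
  abs_XZ : |φ (X * Z)| ≤ 20 * η
  abs_ZXZ : |φ (Z * X * Z)| ≤ 42 * η
  ZZ : 1 - φ (Z * Z) ≤ 9 * η
  XX : 1 - φ (X * X) ≤ 9 * η
  ZXXZ : 1 - φ (Z * X * X * Z) ≤ 18 * η

/-- Two parties `(x, z)` and `(u, v)` together with the observable `m` of the others: if `z ≈ v`,
`x ≈ m u`, all of them square to `1` approximately and `x, z` approximately anticommute, then both
parties have approximate Pauli moments. -/
theorem isApproxPauli_of_stabilized {φ : A →ₗ[ℝ] ℝ} (h : IsState φ) {x z u v m : A}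
    (hx : IsObservable x) (hz : IsObservable z) (hu : IsObservable u) (hv : IsObservable v)
    (hm : IsObservable m) (xu : Commute x u) (xv : Commute x v) (xm : Commute x m)
    (zu : Commute z u) (zv : Commute z v) (zm : Commute z m) (mu : Commute m u) (mv : Commute m v)
    {η : ℝ} (hxb : gnsNorm φ (x - m * u) ≤ 4 * η) (hzv : gnsNorm φ (z - v) ≤ 4 * η)
    (hb : gnsNorm φ (m * u * (m * u) - 1) ≤ η) (huu : gnsNorm φ (u * u - 1) ≤ η)
    (hvv : gnsNorm φ (v * v - 1) ≤ η)
    (hxx : gnsNorm φ (x * x - 1) ≤ 9 * η) (hzz : gnsNorm φ (z * z - 1) ≤ 9 * η)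
    (hxz : gnsNorm φ (x * z + z * x) ≤ 20 * η) :
    IsApproxPauli φ x z η ∧ IsApproxPauli φ u v η := by
  have hη : 0 ≤ η := (gnsNorm_nonneg _ _).trans huu
  -- Each use of `R` or `L` turns a relation `q ≈ 0` into a linear inequality between moments, with
  -- `q` on the right or on the left. The rest of the proof is linear arithmetic in these moments.
  have R : ∀ (q : A) {c : ℝ} (_ : gnsNorm φ q ≤ c) (p : A) (_ : IsContraction p),
      |φ (star p * q)| ≤ c := fun q c hq p hp => (hp.abs_star_mul_le h q).trans hq
  have L : ∀ (q : A) {c : ℝ} (_ : gnsNorm φ q ≤ c) (p : A) (_ : IsContraction p),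
      |φ (star q * p)| ≤ c := fun q c hq p hp => (hp.abs_mul_star_le h q).trans hq
  have cx := hx.contr
  have cz := hz.contr
  have cu := hu.contr
  have cv := hv.contr
  have cm := hm.contr
  have sx := hx.star_eq
  have sz := hz.star_eq
  have su := hu.star_eq
  have sv := hv.star_eq
  have sm := hm.star_eq
  have c1 : IsContraction (1 : A) := IsContraction.one
  -- `x m u ≈ 1`
  have hS : gnsNorm φ (x * (m * u) - 1) ≤ 5 * η := by
    have e : x * (m * u) - 1 = m * u * (x - m * u) + (m * u * (m * u) - 1) := by
      rw [(xm.mul_right xu).eq]; noncomm_ring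
    rw [e]
    have a1 := h.gnsNorm_add_le (m * u * (x - m * u)) (m * u * (m * u) - 1)
    have a2 := (cm.mul cu).gnsNorm_mul_le h.toIsPositiveFunctional (x - m * u)
    linarith
  have h1 := h.map_one
  -- The chain is `φ(z) ≈ φ(xxz) ≈ -φ(xzx) ≈ -φ(z)`: anticommutation flips the sign, and `x ≈ m u`
  -- moves the two outer factors to parties that commute with `z`. The moments of `x` and `x m` are
  -- handled likewise with `z ≈ v`.
  have z1 := L _ hxx z cz
  have z2 := R _ hxz x cx
  have z3 := L _ hxb (z * x) (cz.mul cx)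
  have z4 := R _ hxb (z * (m * u)) (cz.mul (cm.mul cu))
  have z5 := R _ hb z cz
  have v1 := R _ hzv 1 c1
  -- `φ (x m)`
  have x1 := R _ hvv (x * m) (cx.mul cm)
  have x2 := L _ hzv (x * m * v) ((cx.mul cm).mul cv)
  have x3 := R _ hzv (x * m * z) ((cx.mul cm).mul cz)
  have x4 := L _ hxz (m * z) (cm.mul cz)
  have x5 := R _ hzz (x * m) (cx.mul cm)
  -- `φ x`
  have y1 := R _ hvv x cx
  have y2 := L _ hzv (x * v) (cx.mul cv)
  have y3 := R _ hzv (x * z) (cx.mul cz)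
  have y4 := L _ hxz z cz
  have y5 := R _ hzz x cx
  have u1 := R _ hS u cu
  have u2 := R _ huu (x * m) (cx.mul cm)
  -- `φ (x z)`
  have p1 := R _ hxz 1 c1
  -- In a real state `φ(xz) = φ(zx)`, so the bound on the anticommutator bounds `φ(xz)` itself.
  have p2 := h.star_mul_comm x z
  have q1 := R _ hzv u cu
  have q2 := L _ hS (u * z) (cu.mul cz)
  have q3 := R _ hxz (m * u * u) ((cm.mul cu).mul cu)
  have q4 := R _ hS (u * z) (cu.mul cz)
  have r1 := L _ hzv (x * z) (cx.mul cz)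
  have r2 := R _ hzv (x * v) (cx.mul cv)
  have r3 := R _ hvv x cx
  have s1 := L _ hzv (u * v) (cu.mul cv)
  have s2 := R _ hzv (u * z) (cu.mul cz)
  have s3 := R _ hzz u cu
  have zz := R _ hzz 1 c1
  have vv := R _ hvv 1 c1
  have xx := R _ hxx 1 c1
  have uu := R _ huu 1 c1
  have t1 := L _ hzv (x * x * z) ((cx.mul cx).mul cz)
  have t2 := R _ hzv (x * x * v) ((cx.mul cx).mul cv)
  have t3 := R _ hvv (x * x) (cx.mul cx)
  have w1 := L _ hzv (u * u * v) ((cu.mul cu).mul cv)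
  have w2 := R _ hzv (u * u * z) ((cu.mul cu).mul cz)
  have w3 := R _ hzz (u * u) (cu.mul cu)
  -- Normal form of a monomial: a word in `x, z`, then `m`, then a word in `u, v`. Equal moments
  -- become identical atoms for `linarith`.
  simp only [star_mul, star_sub, star_add, star_one, sx, sz, su, sv, sm, mul_sub, sub_mul, mul_add,
    add_mul, mul_one, one_mul, map_sub, map_add, mul_assoc, ← xu.eq, ← xv.eq, ← xm.eq, ← zu.eq,
    ← zv.eq, ← zm.eq, ← mu.eq, xu.symm.left_comm, xv.symm.left_comm, xm.symm.left_comm,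
    zu.symm.left_comm, zm.symm.left_comm, mu.symm.left_comm, mv.symm.left_comm,
    abs_le, h1] at *
  refine ⟨⟨?_, ?_, ?_, ?_, ?_, ?_, ?_⟩, ⟨?_, ?_, ?_, ?_, ?_, ?_, ?_⟩⟩ <;>
  (try simp only [mul_assoc, abs_le]) <;>
  first | linarith | (constructor <;> linarith)

end ApproximateStabilizers

/-! ### Tensor products of parties and the self-test of the GHZ state -/

section StarTensor

variable {ι : Type*} [Fintype ι] [DecidableEq ι] {𝒜 : ι → Type*} [∀ i, Ring (𝒜 i)]
  [∀ i, Algebra ℝ (𝒜 i)] [∀ i, StarRing (𝒜 i)] [∀ i, StarModule ℝ (𝒜 i)]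
  {A : Type*} [Ring A] [Algebra ℝ A] [StarRing A] [StarModule ℝ A]

/-- A multilinear map that is multiplicative and compatible with the involutions, like the map
`(Oᵢ) ↦ ⨂ᵢ Oᵢ`. -/
structure IsStarTensor (T : MultilinearMap ℝ 𝒜 A) : Prop where
  map_one : T 1 = 1
  map_mul : ∀ O O', T (O * O') = T O * T O'
  map_star : ∀ O, T (star O) = star (T O)

namespace IsStarTensor

variable {T : MultilinearMap ℝ 𝒜 A} (hT : IsStarTensor T)

/-- The embedding of the algebra of a single party. -/
def emb (k : ι) : 𝒜 k →⋆ₐ[ℝ] A where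
  toFun a := T (Pi.mulSingle k a)
  map_one' := by simp [hT.map_one]
  map_mul' a b := by rw [Pi.mulSingle_mul, hT.map_mul]
  map_zero' := T.map_update_zero 1 k
  map_add' a b := T.map_update_add 1 k a b
  commutes' r := by
    rw [Algebra.algebraMap_eq_smul_one, Algebra.algebraMap_eq_smul_one]
    refine (T.map_update_smul 1 k r 1).trans ?_
    have : Function.update (1 : ∀ i, 𝒜 i) k 1 = 1 := Function.update_eq_self k (1 : ∀ i, 𝒜 i)
    rw [this, hT.map_one]
  map_star' a := by
    rw [← hT.map_star]
    congr 1
    ext i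
    by_cases h : i = k
    · subst h; simp
    · simp [Pi.mulSingle_eq_of_ne h]

theorem emb_apply (k : ι) (a : 𝒜 k) : hT.emb k a = T (Pi.mulSingle k a) := rfl

theorem commute_emb {i j : ι} (hij : i ≠ j) (a : 𝒜 i) (b : 𝒜 j) :
    Commute (hT.emb i a) (hT.emb j b) := by
  have := Pi.mulSingle_commute hij a b
  unfold Commute SemiconjBy at *
  rw [emb_apply, emb_apply, ← hT.map_mul, this, hT.map_mul]

theorem commute_emb_of_eq_one {i : ι} (a : 𝒜 i) {O : ∀ k, 𝒜 k} (hO : O i = 1) :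
    Commute (hT.emb i a) (T O) := by
  unfold Commute SemiconjBy
  rw [emb_apply, ← hT.map_mul, ← hT.map_mul]
  congr 1
  ext k
  by_cases h : k = i
  · subst h; simp [hO]
  · simp [Pi.mulSingle_eq_of_ne h]

include hT in
theorem isContraction {O : ∀ k, 𝒜 k} (hO : ∀ k, IsContraction (O k)) : IsContraction (T O) := by
  have key : ∀ s : Finset ι, IsContraction (T fun k => if k ∈ s then O k else 1) := by
    intro s
    induction s using Finset.induction_on with
    | empty =>
      have : T (fun k => if k ∈ (∅ : Finset ι) then O k else 1) = 1 := by
        rw [← hT.map_one]; congr 1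
      rw [this]; exact IsContraction.one
    | insert a s ha ih =>
      convert ((hO a).map (hT.emb a)).mul ih using 1
      rw [emb_apply, ← hT.map_mul]
      congr 1
      ext k
      by_cases h : k = a
      · subst h; simp [ha]
      · simp [h]
  simpa using key Finset.univ

include hT in
theorem isObservable {O : ∀ k, 𝒜 k} (hO : ∀ k, IsObservable (O k)) : IsObservable (T O) := by
  refine ⟨?_, hT.isContraction fun k => (hO k).contr⟩
  rw [← hT.map_star]
  congr 1
  ext k
  exact (hO k).star_eq

end IsStarTensor

theorem IsContraction.two_thirds_of_half {x y : A} (hx : IsContraction x) (hy : IsContraction y) :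
    IsContraction ((2 / 3 : ℝ) • ((√2)⁻¹ • (x + y))) := by
  have h := (hx.half_add hy).smul (c := 4 / 3 * (√2)⁻¹) (by
    rw [mul_pow, inv_pow, Real.sq_sqrt (by norm_num)]; norm_num)
  convert h using 1
  module

/-- Before clipping, `xz + zx = α₀² - α₁²` exactly, and both squares are close to `1`. Clipping is
then undone one factor at a time, with the commuting partners `b` and `ζ` as intermediaries. -/
theorem anticommutator_clip_le {φ : A →ₗ[ℝ] ℝ} (h : IsState φ) {α₀ α₁ b ζ : A}
    (h₀ : IsObservable α₀) (h₁ : IsObservable α₁) (hb : IsObservable b) (hζ : IsObservable ζ)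
    {x z : A} (hx : x = (√2)⁻¹ • (α₀ + α₁)) (hz : z = (√2)⁻¹ • (α₀ - α₁))
    (cx : Commute x ζ) (cz : Commute z b) (cx' : Commute x b) (cz' : Commute z ζ) {η : ℝ}
    (hxb : gnsNorm φ (x - b) ≤ η) (hzζ : gnsNorm φ (z - ζ) ≤ η)
    (hbb : gnsNorm φ (b * b - 1) ≤ η) (hζζ : gnsNorm φ (ζ * ζ - 1) ≤ η)
    (h00 : gnsNorm φ (α₀ * α₀ - 1) ≤ η) (h11 : gnsNorm φ (α₁ * α₁ - 1) ≤ η) :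
    gnsNorm φ (clip x * clip z + clip z * clip x) ≤ 20 * η := by
  have hP := h.toIsPositiveFunctional
  have sx : star x = x := by simp [hx, h₀.star_eq, h₁.star_eq]
  have sz : star z = z := by simp [hz, h₀.star_eq, h₁.star_eq]
  have kx : IsContraction ((2 / 3 : ℝ) • x) := by
    rw [hx]; exact h₀.contr.two_thirds_of_half h₁.contr
  have kz : IsContraction ((2 / 3 : ℝ) • z) := by
    rw [hz, sub_eq_add_neg]; exact h₀.contr.two_thirds_of_half h₁.contr.neg
  obtain ⟨x1, x2, -⟩ := clip_approx h sx kx hb cx' hxb hbb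
  obtain ⟨z1, z2, -⟩ := clip_approx h sz kz hζ cz' hzζ hζζ
  have bd : ∀ {w : A}, IsContraction ((2 / 3 : ℝ) • w) → ∀ y,
      gnsNorm φ (w * y) ≤ 3 / 2 * gnsNorm φ y := by
    intro w hw y
    have := hw.gnsNorm_mul_le hP y
    rw [smul_mul_assoc, IsPositiveFunctional.gnsNorm_smul, abs_of_pos (by norm_num)] at this
    linarith
  have e0 : x * z + z * x = (α₀ * α₀ - 1) - (α₁ * α₁ - 1) := by
    have h2 : (√2)⁻¹ ^ 2 * 2 = (1 : ℝ) := by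
      rw [inv_pow, Real.sq_sqrt (by norm_num)]; norm_num
    simp only [hx, hz, smul_mul_assoc, mul_smul_comm, add_mul, mul_add, sub_mul, mul_sub]
    match_scalars <;> first | linear_combination h2 | linear_combination -h2 | ring
  have e1 : clip x * clip z - x * z = clip x * (clip z - ζ) + ζ * (clip x - x) + x * (ζ - z) := by
    simp only [mul_sub, cx.eq, cx.clip_left.eq]; abel
  have e2 : clip z * clip x - z * x = clip z * (clip x - b) + b * (clip z - z) + z * (b - x) := by
    simp only [mul_sub, cz.eq, cz.clip_left.eq]; abel
  have e : clip x * clip z + clip z * clip x =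
      (clip x * clip z - x * z) + (clip z * clip x - z * x) + (x * z + z * x) := by abel
  have n0 : gnsNorm φ (x * z + z * x) ≤ 2 * η := by
    rw [e0]
    have := hP.gnsNorm_sub_le (α₀ * α₀ - 1) (α₁ * α₁ - 1)
    linarith
  have n1 : gnsNorm φ (clip x * clip z - x * z) ≤ 17 / 2 * η := by
    rw [e1]
    have a1 := hP.gnsNorm_add_le (clip x * (clip z - ζ) + ζ * (clip x - x)) (x * (ζ - z))
    have a2 := hP.gnsNorm_add_le (clip x * (clip z - ζ)) (ζ * (clip x - x))
    have a3 := (IsObservable.clip sx kx).contr.gnsNorm_mul_le hP (clip z - ζ)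
    have a4 := hζ.contr.gnsNorm_mul_le hP (clip x - x)
    have a5 := bd kx (ζ - z)
    rw [IsPositiveFunctional.gnsNorm_sub_comm] at hzζ
    linarith
  have n2 : gnsNorm φ (clip z * clip x - z * x) ≤ 17 / 2 * η := by
    rw [e2]
    have a1 := hP.gnsNorm_add_le (clip z * (clip x - b) + b * (clip z - z)) (z * (b - x))
    have a2 := hP.gnsNorm_add_le (clip z * (clip x - b)) (b * (clip z - z))
    have a3 := (IsObservable.clip sz kz).contr.gnsNorm_mul_le hP (clip x - b)
    have a4 := hb.contr.gnsNorm_mul_le hP (clip z - z)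
    have a5 := bd kz (b - x)
    rw [IsPositiveFunctional.gnsNorm_sub_comm] at hxb
    linarith
  rw [e]
  have a1 := hP.gnsNorm_add_le ((clip x * clip z - x * z) + (clip z * clip x - z * x))
    (x * z + z * x)
  have a2 := hP.gnsNorm_add_le (clip x * clip z - x * z) (clip z * clip x - z * x)
  have := (gnsNorm_nonneg _ _).trans hxb
  linarith

/-- The `X`-type observables of the star network: the clipped combination `(a₀ + a₁)/√2` for the
distinguished party `o` and `a₁` for the others. -/
noncomputable def xObs (o : ι) (a₀ a₁ : ∀ k, 𝒜 k) (k : ι) : 𝒜 k :=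
  if k = o then clip ((√2)⁻¹ • (a₀ k + a₁ k)) else a₁ k

/-- The `Z`-type observables of the star network: the clipped combination `(a₀ - a₁)/√2` for the
distinguished party `o` and `a₀` for the others. -/
noncomputable def zObs (o : ι) (a₀ a₁ : ∀ k, 𝒜 k) (k : ι) : 𝒜 k :=
  if k = o then clip ((√2)⁻¹ • (a₀ k - a₁ k)) else a₀ k

variable {o : ι} {a₀ a₁ : ∀ k, 𝒜 k}

theorem IsObservable.xObs (h₀ : ∀ k, IsObservable (a₀ k)) (h₁ : ∀ k, IsObservable (a₁ k)) (k : ι) :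
    IsObservable (xObs o a₀ a₁ k) := by
  unfold _root_.xObs
  split_ifs
  · exact .clip (by simp [(h₀ k).star_eq, (h₁ k).star_eq])
      ((h₀ k).contr.two_thirds_of_half (h₁ k).contr)
  · exact h₁ k

theorem IsObservable.zObs (h₀ : ∀ k, IsObservable (a₀ k)) (h₁ : ∀ k, IsObservable (a₁ k)) (k : ι) :
    IsObservable (zObs o a₀ a₁ k) := by
  unfold _root_.zObs
  split_ifs
  · refine .clip (by simp [(h₀ k).star_eq, (h₁ k).star_eq]) ?_
    rw [sub_eq_add_neg]
    exact (h₀ k).contr.two_thirds_of_half (h₁ k).contr.neg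
  · exact h₀ k

/-- The conclusions of the approximate self-test of a GHZ state. -/
structure IsNearGHZ {T : MultilinearMap ℝ 𝒜 A} (hT : IsStarTensor T) (φ : A →ₗ[ℝ] ℝ) (o : ι)
    (X Z : ∀ k, 𝒜 k) (η : ℝ) : Prop where
  prod_X : gnsNorm φ (T X - 1) ≤ 5 * η
  X_sq : ∀ k, gnsNorm φ (hT.emb k (X k) * hT.emb k (X k) - 1) ≤ 9 * η
  Z_sq : ∀ k, gnsNorm φ (hT.emb k (Z k) * hT.emb k (Z k) - 1) ≤ 9 * η
  Z_sub : ∀ k, gnsNorm φ (hT.emb k (Z k) - hT.emb o (Z o)) ≤ 4 * η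
  pauli : ∀ k, IsApproxPauli φ (hT.emb k (X k)) (hT.emb k (Z k)) η

/-- A nearly maximal value of the Bell functional self-tests the GHZ state. -/
theorem isNearGHZ_of_bell {T : MultilinearMap ℝ 𝒜 A} (hT : IsStarTensor T) {φ : A →ₗ[ℝ] ℝ}
    (h : IsState φ) (hι : 2 ≤ Fintype.card ι) (h₀ : ∀ k, IsObservable (a₀ k))
    (h₁ : ∀ k, IsObservable (a₁ k)) {η : ℝ} (hη : 0 ≤ η)
    (hI : 2 * ((Fintype.card ι : ℝ) - 1) - η ^ 2 / 2 ≤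
      ((Fintype.card ι : ℝ) - 1) *
          φ (T fun i => if i = o then (√2)⁻¹ • (a₀ i + a₁ i) else a₁ i) +
        ∑ j with j ≠ o,
          φ (T fun i => if i = o then (√2)⁻¹ • (a₀ i - a₁ i) else if i = j then a₀ i else 1)) :
    IsNearGHZ hT φ o (xObs o a₀ a₁) (zObs o a₀ a₁) η ∧
      gnsNorm φ (hT.emb o ((√2)⁻¹ • (a₀ o + a₁ o)) - hT.emb o (xObs o a₀ a₁ o)) ≤ 3 * η := by
  have hP := h.toIsPositiveFunctional
  set B : ∀ k, 𝒜 k := fun k => if k = o then 1 else a₁ k with hB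
  set s : Finset ι := Finset.univ.filter (· ≠ o) with hs
  have hcard : (s.card : ℝ) = (Fintype.card ι : ℝ) - 1 := by
    rw [hs, Finset.filter_ne', Finset.card_erase_of_mem (Finset.mem_univ _), Finset.card_univ,
      Nat.cast_sub (by omega)]
    simp
  have hsne : s.Nonempty := by
    have : (0 : ℝ) < s.card := by
      rw [hcard]
      have : (2 : ℝ) ≤ Fintype.card ι := by exact_mod_cast hι
      linarith
    exact Finset.card_pos.1 (by exact_mod_cast this)
  have hBo : IsObservable (T B) := by
    refine hT.isObservable fun k => ?_
    simp only [hB]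
    split_ifs
    exacts [.one, h₁ k]
  set x := hT.emb o ((√2)⁻¹ • (a₀ o + a₁ o)) with hx
  set z := hT.emb o ((√2)⁻¹ • (a₀ o - a₁ o)) with hz
  have hx' : x = (√2)⁻¹ • (hT.emb o (a₀ o) + hT.emb o (a₁ o)) := by simp [hx]
  have hz' : z = (√2)⁻¹ • (hT.emb o (a₀ o) - hT.emb o (a₁ o)) := by simp [hz]
  have t1 : T (fun i => if i = o then (√2)⁻¹ • (a₀ i + a₁ i) else a₁ i) = x * T B := by
    rw [hx, hT.emb_apply, ← hT.map_mul]
    congr 1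
    ext i
    by_cases hi : i = o
    · subst hi; simp [hB]
    · simp [hB, hi]
  have t2 : ∀ j ∈ s, T (fun i => if i = o then (√2)⁻¹ • (a₀ i - a₁ i) else
      if i = j then a₀ i else 1) = z * hT.emb j (a₀ j) := by
    intro j hj
    have hjo : j ≠ o := by simpa [hs] using hj
    rw [hz, hT.emb_apply, hT.emb_apply, ← hT.map_mul]
    congr 1
    ext i
    by_cases hi : i = o
    · subst hi; simp [Pi.mulSingle_eq_of_ne hjo.symm]
    · by_cases hij : i = j
      · subst hij; simp [hi]
      · simp [hi, hij]
  rw [t1, Finset.sum_congr rfl fun j hj => by rw [t2 j hj], ← hcard] at hI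
  obtain ⟨xb, q0, q1, qb, hj⟩ := bell_sum_of_squares h hsne ((h₀ o).map (hT.emb o))
    ((h₁ o).map (hT.emb o)) hBo (fun j _ => (h₀ j).map (hT.emb j)) hx' hz' hη hI
  have hbb := hBo.gnsNorm_sq_sub_one_le h hη qb
  have h00 := ((h₀ o).map (hT.emb o)).gnsNorm_sq_sub_one_le h hη q0
  have h11 := ((h₁ o).map (hT.emb o)).gnsNorm_sq_sub_one_le h hη q1
  have cB : ∀ a, Commute (hT.emb o a) (T B) := fun a => hT.commute_emb_of_eq_one a (by simp [hB])
  have sx : star x = x := by simp [hx', ← map_star, (h₀ o).star_eq, (h₁ o).star_eq]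
  have sz : star z = z := by simp [hz', ← map_star, (h₀ o).star_eq, (h₁ o).star_eq]
  have kx : IsContraction ((2 / 3 : ℝ) • x) := by
    rw [hx']; exact ((h₀ o).map (hT.emb o)).contr.two_thirds_of_half ((h₁ o).map (hT.emb o)).contr
  have kz : IsContraction ((2 / 3 : ℝ) • z) := by
    rw [hz', sub_eq_add_neg]
    exact ((h₀ o).map (hT.emb o)).contr.two_thirds_of_half ((h₁ o).map (hT.emb o)).contr.neg
  obtain ⟨x1, x2, x3⟩ := clip_approx h sx kx hBo (cB _) xb hbb
  have X0 : hT.emb o (xObs o a₀ a₁ o) = clip x := by simp [xObs, map_clip, hx]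
  have Z0 : hT.emb o (zObs o a₀ a₁ o) = clip z := by simp [zObs, map_clip, hz]
  have Xj : ∀ j ≠ o, xObs o a₀ a₁ j = a₁ j := fun j hj => by simp [xObs, hj]
  have Zj : ∀ j ≠ o, zObs o a₀ a₁ j = a₀ j := fun j hj => by simp [zObs, hj]
  have hXobs := IsObservable.xObs (o := o) h₀ h₁
  have hZobs := IsObservable.zObs (o := o) h₀ h₁
  have main : ∀ j, j ≠ o → gnsNorm φ (clip z - hT.emb j (a₀ j)) ≤ 4 * η ∧
      gnsNorm φ (clip z * clip z - 1) ≤ 9 * η ∧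
      gnsNorm φ (hT.emb j (a₀ j) * hT.emb j (a₀ j) - 1) ≤ η ∧
      gnsNorm φ (hT.emb j (a₁ j) * hT.emb j (a₁ j) - 1) ≤ η ∧
      IsApproxPauli φ (clip x) (clip z) η ∧
      IsApproxPauli φ (hT.emb j (a₁ j)) (hT.emb j (a₀ j)) η := by
    intro j hjo
    obtain ⟨zj, qj⟩ := hj j (by simp [hs, hjo])
    have oz := (h₀ j).map (hT.emb j)
    have ox := (h₁ j).map (hT.emb j)
    have vv := oz.gnsNorm_sq_sub_one_le h hη qj
    have co : ∀ a b, Commute (hT.emb o a) (hT.emb j b) := fun a b => hT.commute_emb hjo.symm a b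
    obtain ⟨z1, z2, z3⟩ := clip_approx h sz kz oz (co _ _) zj vv
    have anti := anticommutator_clip_le h ((h₀ o).map (hT.emb o)) ((h₁ o).map (hT.emb o)) hBo oz
      hx' hz' (co _ _) (cB _) (cB _) (co _ _) xb zj hbb vv h00 h11
    set M : ∀ k, 𝒜 k := fun k => if k = o ∨ k = j then 1 else a₁ k with hM
    have hMo : IsObservable (T M) := by
      refine hT.isObservable fun k => ?_
      simp only [hM]
      split_ifs
      exacts [.one, h₁ k]
    have hBM : T B = T M * hT.emb j (a₁ j) := by
      rw [hT.emb_apply, ← hT.map_mul]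
      congr 1
      ext i
      by_cases hij : i = j
      · subst hij; simp [hB, hM, hjo]
      · by_cases hi : i = o
        · subst hi; simp [hB, hM, Pi.mulSingle_eq_of_ne hij]
        · simp [hB, hM, hij, hi]
    -- The observable of party `j` alone squares nearly to `1` because it is a factor of `T B`: the
    -- cofactor `T M` is a contraction, so `φ(u²) ≥ φ((T B)²)`.
    have uu : gnsNorm φ (hT.emb j (a₁ j) * hT.emb j (a₁ j) - 1) ≤ η := by
      refine ox.gnsNorm_sq_sub_one_le h hη ?_
      have e1 := hP.gnsNorm_sq (T B)
      have e2 := hP.gnsNorm_sq (hT.emb j (a₁ j))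
      rw [hBo.star_eq] at e1
      rw [ox.star_eq] at e2
      have e3 : gnsNorm φ (T B) ≤ gnsNorm φ (hT.emb j (a₁ j)) := by
        rw [hBM]; exact hMo.contr.gnsNorm_mul_le hP _
      have := gnsNorm_nonneg φ (T B)
      nlinarith
    have cM : ∀ a, Commute (hT.emb o a) (T M) :=
      fun a => hT.commute_emb_of_eq_one a (by simp [hM])
    have cM' : ∀ a, Commute (T M) (hT.emb j a) :=
      fun a => (hT.commute_emb_of_eq_one a (by simp [hM])).symm
    have P := isApproxPauli_of_stabilized h (IsObservable.clip sx kx) (IsObservable.clip sz kz)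
      ox oz hMo (co _ _).clip_left (co _ _).clip_left (cM _).clip_left (co _ _).clip_left
      (co _ _).clip_left (cM _).clip_left (cM' _) (cM' _) (hBM ▸ x2) z2 (hBM ▸ hbb) uu vv x3 z3 anti
    exact ⟨z2, z3, vv, uu, P.1, P.2⟩
  -- The relations for `Z` at the distinguished party are certified by any one other party.
  obtain ⟨j₀, hj₀⟩ := hsne
  have hj₀ : j₀ ≠ o := by simpa [hs] using hj₀
  refine ⟨⟨?_, ?_, ?_, ?_, ?_⟩, ?_⟩
  · have e : T (xObs o a₀ a₁) = T B * clip x := by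
      rw [← X0, ← (cB _).eq, hT.emb_apply, ← hT.map_mul]
      congr 1
      ext i
      by_cases hi : i = o
      · subst hi; simp [hB]
      · simp [hB, hi, Xj i hi]
    have e' : T (xObs o a₀ a₁) - 1 = T B * (clip x - T B) + (T B * T B - 1) := by
      rw [e]; noncomm_ring
    rw [e']
    have a1 := hP.gnsNorm_add_le (T B * (clip x - T B)) (T B * T B - 1)
    have a2 := hBo.contr.gnsNorm_mul_le hP (clip x - T B)
    linarith
  · intro k
    by_cases hk : k = o
    · subst hk; rw [X0]; exact x3
    · rw [Xj k hk]
      have := (main k hk).2.2.2.1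
      linarith
  · intro k
    by_cases hk : k = o
    · subst hk; rw [Z0]; exact (main j₀ hj₀).2.1
    · rw [Zj k hk]
      have := (main k hk).2.2.1
      linarith
  · intro k
    by_cases hk : k = o
    · subst hk; rw [sub_self]; simpa [gnsNorm] using hη
    · rw [Zj k hk, Z0, IsPositiveFunctional.gnsNorm_sub_comm]
      exact (main k hk).1
  · intro k
    by_cases hk : k = o
    · subst hk; rw [X0, Z0]; exact (main j₀ hj₀).2.2.2.2.1
    · rw [Xj k hk, Zj k hk]
      exact (main k hk).2.2.2.2.2
  · rw [X0, IsPositiveFunctional.gnsNorm_sub_comm]; exact x1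

end StarTensor

theorem sum_mul_sum_eq_diag_add_offDiag {ι R : Type*} [Fintype ι] [DecidableEq ι]
    [NonUnitalNonAssocSemiring R] (f g : ι → R) :
    (∑ i, f i) * (∑ i, g i) =
      ∑ i, f i * g i + ∑ p ∈ Finset.univ.offDiag, f p.1 * g p.2 := by
  rw [Finset.sum_mul_sum, ← Finset.sum_product', ← Finset.diag_union_offDiag,
    Finset.sum_union (Finset.disjoint_diag_offDiag _), Finset.sum_diag]

/-! ### Single-party factors of the GHZ projection -/

section LocalProjection

variable {A : Type*} [Ring A] [Algebra ℝ A] [StarRing A] [StarModule ℝ A]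

/-- `(1 ± z)/2`. -/
noncomputable def halfProj (b : Bool) (z : A) : A := (1 / 2 : ℝ) • (1 + bitSign b • z)

theorem IsObservable.halfProj {z : A} (hz : IsObservable z) (b : Bool) :
    IsObservable (halfProj b z) := by
  cases b
  · simp only [_root_.halfProj, bitSign, Bool.false_eq_true, if_false, one_smul]
    exact ⟨by simp [hz.star_eq], IsContraction.one.half_add hz.contr⟩
  · simp only [_root_.halfProj, bitSign, if_true, neg_one_smul]
    exact ⟨by simp [hz.star_eq], IsContraction.one.half_add hz.contr.neg⟩

/-- The local factors `X^a (1 ± Z)/2` of the operators whose sum is twice the GHZ projection. -/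
noncomputable def ghzFactor (X Z : A) (c : Bool × Bool) : A :=
  (if c.1 then X else 1) * halfProj c.2 Z

variable {X Z : A}

theorem IsContraction.ghzFactor (hX : IsObservable X) (hZ : IsObservable Z) (c : Bool × Bool) :
    IsContraction (ghzFactor X Z c) := by
  unfold _root_.ghzFactor
  refine IsContraction.mul ?_ (hZ.halfProj _).contr
  split_ifs
  exacts [hX.contr, .one]

theorem IsContraction.star_ghzFactor (hX : IsObservable X) (hZ : IsObservable Z)
    (c : Bool × Bool) : IsContraction (star (_root_.ghzFactor X Z c)) := by
  unfold _root_.ghzFactor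
  rw [star_mul, (hZ.halfProj _).star_eq]
  refine (hZ.halfProj _).contr.mul ?_
  split_ifs
  · rw [hX.star_eq]; exact hX.contr
  · rw [star_one]; exact .one

variable {e : A →ₗ[ℝ] ℝ} (he : IsState e) (hX : IsObservable X) (hZ : IsObservable Z) {η : ℝ}
  (hP : IsApproxPauli e X Z η)
include he hX hZ hP

/-- For exact Pauli matrices the four factors are the matrix units, orthogonal and of squared norm
`1/2` in the normalised trace. This is the norm; `abs_ghzFactor_le` is the orthogonality. -/
theorem ghzFactor_self_le (c : Bool × Bool) :
    e (star (ghzFactor X Z c) * ghzFactor X Z c) ≤ 1 / 2 + 13 * η := by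
  have hη : 0 ≤ η := by have := (abs_nonneg _).trans hP.abs_Z; linarith
  have h1 : ∀ b, e (star (halfProj b Z) * halfProj b Z) ≤ 1 / 2 + 13 * η := by
    intro b
    have hZZ := hZ.contr
    have := he.nonneg_of_mem hZZ
    rw [map_sub, he.map_one, hZ.star_eq] at this
    have h2 := abs_le.1 hP.abs_Z
    have h3 : |bitSign b| ≤ 1 := by cases b <;> simp [bitSign]
    have h3' : bitSign b * bitSign b = 1 := by cases b <;> simp [bitSign]
    have h4 : |bitSign b * e Z| ≤ 25 * η := by
      rw [abs_mul]
      exact (mul_le_mul h3 hP.abs_Z (abs_nonneg _) zero_le_one).trans (by simp)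
    have h5 := abs_le.1 h4
    rw [(hZ.halfProj b).star_eq]
    simp only [halfProj, smul_mul_assoc, mul_smul_comm, add_mul, mul_add, one_mul, mul_one,
      map_smul, map_add, he.map_one, smul_eq_mul]
    have h6 : bitSign b * (1 / 2 * (bitSign b * e (Z * Z))) = 1 / 2 * e (Z * Z) := by
      linear_combination (1 / 2 * e (Z * Z)) * h3'
    linarith
  obtain ⟨a, b⟩ := c
  cases a
  · simpa [ghzFactor] using h1 b
  · simp only [ghzFactor, if_true]
    have h6 := hX.contr.gnsNorm_mul_le he.toIsPositiveFunctional (halfProj b Z)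
    have h7 := pow_le_pow_left₀ (gnsNorm_nonneg _ _) h6 2
    rw [he.gnsNorm_sq, he.gnsNorm_sq] at h7
    exact h7.trans (h1 b)

theorem abs_ghzFactor_le {c c' : Bool × Bool} (hc : c ≠ c') :
    |e (star (ghzFactor X Z c) * ghzFactor X Z c')| ≤ 27 * η := by
  have hη : 0 ≤ η := by have := (abs_nonneg _).trans hP.abs_Z; linarith
  have hle : ∀ {y : A}, IsContraction y → e (star y * y) ≤ 1 := by
    intro y hy
    have := he.nonneg_of_mem hy
    rw [map_sub, he.map_one] at this
    linarith
  have zz := hle hZ.contr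
  have xx := hle hX.contr
  have zxxz := hle (hX.contr.mul hZ.contr)
  have zx := he.star_mul_comm X Z
  have xxz := he.star_mul_comm (X * X) Z
  obtain ⟨h1, h2, h3, h4, h5, h6, h7⟩ := hP
  rw [hZ.star_eq] at zz
  rw [hX.star_eq] at xx
  simp only [star_mul, hX.star_eq, hZ.star_eq, mul_assoc] at zxxz zx xxz h4 h7
  rw [abs_le] at h1 h2 h3 h4
  obtain ⟨a, b⟩ := c
  obtain ⟨a', b'⟩ := c'
  cases a <;> cases b <;> cases a' <;> cases b' <;>
  first
  | exact absurd rfl hc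
  | (simp only [ghzFactor, halfProj, bitSign, if_true, Bool.false_eq_true, if_false, one_smul,
      neg_one_smul, smul_mul_assoc, mul_smul_comm, add_mul, mul_add, one_mul, mul_one, star_mul,
      star_one, star_smul, star_add, star_neg, star_trivial, hX.star_eq, hZ.star_eq, neg_mul,
      mul_neg, map_smul, map_add, map_neg, he.map_one, smul_eq_mul, mul_assoc, abs_le]
     constructor <;> linarith)

-- Conjugating a skew element gives a skew element, which a real state annihilates. For complex
-- states this expectation could be imaginary and nonzero, and the bound on `J_N` would be lost.
omit hP in
theorem ghzFactor_skew {K : A} (hK : star K = -K) (c : Bool × Bool) :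
    e (star (ghzFactor X Z c) * K * ghzFactor X Z c) = 0 := by
  have := he.map_star (star (ghzFactor X Z c) * K * ghzFactor X Z c)
  simp only [star_mul, star_star, hK, neg_mul, mul_neg, map_neg, ← mul_assoc] at this
  linarith

omit hP in
theorem abs_ghzFactor_le_one {K : A} (hK : IsContraction K) (c c' : Bool × Bool) :
    |e (star (ghzFactor X Z c) * K * ghzFactor X Z c')| ≤ 1 :=
  (((IsContraction.star_ghzFactor hX hZ c).mul hK).mul
    (IsContraction.ghzFactor hX hZ c')).abs_apply_le_one he

end LocalProjection

/-! ### The approximate GHZ projection in the product state and in the stabilized state -/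

section GHZProjection

variable {ι : Type*} [Fintype ι] [DecidableEq ι] {𝒜 : ι → Type*} [∀ i, Ring (𝒜 i)]
  [∀ i, Algebra ℝ (𝒜 i)] [∀ i, StarRing (𝒜 i)] [∀ i, StarModule ℝ (𝒜 i)]
  {A : Type*} [Ring A] [Algebra ℝ A] [StarRing A] [StarModule ℝ A]

/-- The operator `(1 + ⨂ X)/2 · (⨂ (1+Z)/2 + ⨂ (1-Z)/2)`, an approximate GHZ projection. -/
noncomputable def ghzProj (T : MultilinearMap ℝ 𝒜 A) (X Z : ∀ k, 𝒜 k) : A :=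
  (1 / 2 : ℝ) • ∑ c : Bool × Bool, T fun k => ghzFactor (X k) (Z k) c

theorem sum_bool_prod_le (F : Bool × Bool → Bool × Bool → ℝ) (m r : ℝ)
    (h : ∀ c c', F c c' ≤ if c = c' then m else r) : ∑ c, ∑ c', F c c' ≤ 4 * m + 12 * r := by
  refine (Finset.sum_le_sum fun c _ => Finset.sum_le_sum fun c' _ => h c c').trans ?_
  simp [Fintype.sum_prod_type]
  linarith

variable {T : MultilinearMap ℝ 𝒜 A} (hT : IsStarTensor T) {X Z : ∀ k, 𝒜 k}
  (hX : ∀ k, IsObservable (X k)) (hZ : ∀ k, IsObservable (Z k)) {η : ℝ}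

section Product

variable {ρ : A →ₗ[ℝ] ℝ} {e : ∀ k, 𝒜 k →ₗ[ℝ] ℝ} (hρ : ∀ O, ρ (T O) = ∏ k, e k (O k))
  (he : ∀ k, IsState (e k)) (hP : ∀ k, IsApproxPauli (e k) (X k) (Z k) η)

include hT hρ in
theorem product_conj_ghzProj (O : ∀ k, 𝒜 k) :
    ρ (star (ghzProj T X Z) * T O * ghzProj T X Z) = (1 / 4 : ℝ) * ∑ c, ∑ c',
      ∏ k, e k (star (ghzFactor (X k) (Z k) c) * O k * ghzFactor (X k) (Z k) c') := by
  have key : ∀ c c', ∏ k, e k (star (ghzFactor (X k) (Z k) c) * O k * ghzFactor (X k) (Z k) c') =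
      ρ (star (T fun k => ghzFactor (X k) (Z k) c) * T O *
        T fun k => ghzFactor (X k) (Z k) c') := by
    intro c c'
    rw [← hT.map_star, ← hT.map_mul, ← hT.map_mul, hρ]
    rfl
  simp only [key, ← map_sum, ← Finset.mul_sum, ← Finset.sum_mul]
  simp only [ghzProj, star_smul, star_sum, star_trivial, smul_mul_assoc, mul_smul_comm, map_smul,
    smul_eq_mul]
  ring

-- Of the 16 pairs of product terms, weighted by `1/4`, the 4 diagonal ones have local factors about
-- `1/2` and the 12 others have local factors of order `η`.
include hT hX hZ hρ he hP in
theorem product_ghzProj_sq_le :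
    ρ (star (ghzProj T X Z) * ghzProj T X Z) ≤
      (1 / 2 + 13 * η) ^ Fintype.card ι + 3 * (27 * η) ^ Fintype.card ι := by
  have h := product_conj_ghzProj hT hρ (X := X) (Z := Z) 1
  rw [hT.map_one, mul_one] at h
  rw [h]
  have := sum_bool_prod_le (fun c c' =>
    ∏ k, e k (star (ghzFactor (X k) (Z k) c) * (1 : ∀ k, 𝒜 k) k * ghzFactor (X k) (Z k) c'))
    ((1 / 2 + 13 * η) ^ Fintype.card ι) ((27 * η) ^ Fintype.card ι) ?_
  · linarith
  · intro c c'
    simp only [Pi.one_apply, mul_one]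
    rw [← Finset.card_univ, ← Finset.prod_const, ← Finset.prod_const]
    split_ifs with hc
    · subst hc
      exact Finset.prod_le_prod (fun k _ => (he k).nonneg _)
        fun k _ => ghzFactor_self_le (he k) (hX k) (hZ k) (hP k) c
    · refine (le_abs_self _).trans ?_
      rw [Finset.abs_prod]
      exact Finset.prod_le_prod (fun k _ => abs_nonneg _)
        fun k _ => abs_ghzFactor_le (he k) (hX k) (hZ k) (hP k) hc

-- Diagonal pairs vanish exactly through the skew factor at site `i`. In an off-diagonal pair the
-- sites `i, j` are bounded by `1`, and each of the other `n - 2` sites contributes a factor of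
-- order `η`.
include hX hZ hρ he hP in
theorem abs_product_conj_skew_le {i j : ι} (hij : i ≠ j) {Ki : 𝒜 i} {Kj : 𝒜 j}
    (si : star Ki = -Ki) (ci : IsContraction Ki) (cj : IsContraction Kj) :
    |ρ (star (ghzProj T X Z) * (hT.emb i Ki * hT.emb j Kj) * ghzProj T X Z)| ≤
      3 * (27 * η) ^ (Fintype.card ι - 2) := by
  have e0 : hT.emb i Ki * hT.emb j Kj = T (Pi.mulSingle i Ki * Pi.mulSingle j Kj) := by
    rw [hT.map_mul]; rfl
  rw [e0, product_conj_ghzProj hT hρ, abs_mul, abs_of_pos (by norm_num : (0 : ℝ) < 1 / 4)]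
  set O : ∀ k, 𝒜 k := Pi.mulSingle i Ki * Pi.mulSingle j Kj with hO
  have Oi : O i = Ki := by simp [hO, Pi.mulSingle_eq_of_ne hij]
  have Oj : O j = Kj := by simp [hO, Pi.mulSingle_eq_of_ne hij.symm]
  have Ok : ∀ k, ¬ (k = i ∨ k = j) → O k = 1 := by
    intro k hk
    push Not at hk
    simp [hO, Pi.mulSingle_eq_of_ne hk.1, Pi.mulSingle_eq_of_ne hk.2]
  have hbound := sum_bool_prod_le (fun c c' =>
    |∏ k, e k (star (ghzFactor (X k) (Z k) c) * O k * ghzFactor (X k) (Z k) c')|)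
    0 ((27 * η) ^ (Fintype.card ι - 2)) ?_
  · have h1 : |∑ c, ∑ c', ∏ k, e k (star (ghzFactor (X k) (Z k) c) * O k *
        ghzFactor (X k) (Z k) c')| ≤ ∑ c, ∑ c', |∏ k, e k (star (ghzFactor (X k) (Z k) c) * O k *
        ghzFactor (X k) (Z k) c')| :=
      (Finset.abs_sum_le_sum_abs _ _).trans
        (Finset.sum_le_sum fun c _ => Finset.abs_sum_le_sum_abs _ _)
    linarith
  · intro c c'
    split_ifs with hc
    · subst hc
      rw [Finset.prod_eq_zero (Finset.mem_univ i), abs_zero]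
      rw [Oi]
      exact ghzFactor_skew (he i) (hX i) (hZ i) si c
    · have hcard : (27 * η) ^ (Fintype.card ι - 2) =
          ∏ k, if k = i ∨ k = j then (1 : ℝ) else 27 * η := by
        rw [Finset.prod_ite, Finset.prod_const_one, one_mul, Finset.prod_const]
        congr 1
        have : (Finset.univ.filter fun k => ¬ (k = i ∨ k = j)) =
            (Finset.univ.erase i).erase j := by
          ext k; simp [not_or, and_comm]
        rw [this, Finset.card_erase_of_mem (by simp [hij.symm]),
          Finset.card_erase_of_mem (Finset.mem_univ _), Finset.card_univ]
        omega
      rw [hcard, Finset.abs_prod]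
      refine Finset.prod_le_prod (fun k _ => abs_nonneg _) fun k _ => ?_
      split_ifs with hk
      · refine abs_ghzFactor_le_one (he k) (hX k) (hZ k) ?_ c c'
        rcases hk with rfl | rfl
        · rw [Oi]; exact ci
        · rw [Oj]; exact cj
      · rw [Ok k hk, mul_one]
        exact abs_ghzFactor_le (he k) (hX k) (hZ k) (hP k) hc

end Product

section Stabilized

variable {φ : A →ₗ[ℝ] ℝ} (h : IsState φ) {o : ι} (hN : IsNearGHZ hT φ o X Z η)
include h hN hZ

/-- All `Zₖ` act nearly as `Z_o`, so the product of the `(1 ± Zₖ)/2` acts as a power of the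
approximate idempotent `(1 ± Z_o)/2`. Sites are added one by one; each costs `2η` for replacing `Zₖ`
and `9η/4` for idempotency. -/
theorem gnsNorm_prod_halfProj_sub_le (b : Bool) :
    gnsNorm φ ((T fun k => halfProj b (Z k)) - hT.emb o (halfProj b (Z o))) ≤
      17 / 4 * Fintype.card ι * η := by
  have hPos := h.toIsPositiveFunctional
  have hη : 0 ≤ η := by have := (gnsNorm_nonneg _ _).trans hN.prod_X; linarith
  have hs : bitSign b * bitSign b = 1 := by cases b <;> simp [bitSign]
  have habs : |bitSign b| = 1 := by cases b <;> simp [bitSign]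
  have hp := fun k => (hZ k).halfProj b
  have emb_half : ∀ k, hT.emb k (halfProj b (Z k)) = halfProj b (hT.emb k (Z k)) := by
    intro k; simp [halfProj]
  have h1 : ∀ k, gnsNorm φ (hT.emb k (halfProj b (Z k)) - hT.emb o (halfProj b (Z o))) ≤
      2 * η := by
    intro k
    have e : hT.emb k (halfProj b (Z k)) - hT.emb o (halfProj b (Z o)) =
        (1 / 2 * bitSign b) • (hT.emb k (Z k) - hT.emb o (Z o)) := by
      rw [emb_half, emb_half]; simp only [halfProj]; module
    rw [e, IsPositiveFunctional.gnsNorm_smul, abs_mul, habs]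
    have := hN.Z_sub k
    norm_num
    linarith
  have h2 : gnsNorm φ (hT.emb o (halfProj b (Z o)) * hT.emb o (halfProj b (Z o)) -
      hT.emb o (halfProj b (Z o))) ≤ 9 / 4 * η := by
    have e : hT.emb o (halfProj b (Z o)) * hT.emb o (halfProj b (Z o)) -
        hT.emb o (halfProj b (Z o)) = (1 / 4 : ℝ) • (hT.emb o (Z o) * hT.emb o (Z o) - 1) := by
      rw [emb_half]
      simp only [halfProj, smul_mul_assoc, mul_smul_comm, add_mul, mul_add, one_mul, mul_one]
      match_scalars <;> first | linear_combination (1 / 4 : ℝ) * hs | ring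
    rw [e, IsPositiveFunctional.gnsNorm_smul, abs_of_pos (by norm_num)]
    have := hN.Z_sq o
    linarith
  have key : ∀ s : Finset ι, o ∉ s →
      gnsNorm φ ((T fun k => if k ∈ s ∨ k = o then halfProj b (Z k) else 1) -
        hT.emb o (halfProj b (Z o))) ≤ 17 / 4 * s.card * η := by
    intro s
    induction s using Finset.induction_on with
    | empty =>
      intro _
      have : (T fun k => if k ∈ (∅ : Finset ι) ∨ k = o then halfProj b (Z k) else 1) =
          hT.emb o (halfProj b (Z o)) := by
        rw [hT.emb_apply]
        congr 1
        ext k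
        by_cases hk : k = o
        · subst hk; simp
        · simp [hk]
      rw [this]; simp [gnsNorm]
    | insert a s ha ih =>
      intro ho
      have hoa : o ≠ a := fun h => ho (by simp [h])
      have hos : o ∉ s := fun h => ho (by simp [h])
      have ih := ih hos
      set Q := T fun k => if k ∈ s ∨ k = o then halfProj b (Z k) else 1 with hQ
      set Q' := T fun k => if k ∈ s then halfProj b (Z k) else 1 with hQ'
      have cQ : IsContraction Q := hT.isContraction fun k => by
        split_ifs
        exacts [(hp k).contr, .one]
      have cQ' : IsContraction Q' := hT.isContraction fun k => by
        split_ifs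
        exacts [(hp k).contr, .one]
      have e1 : (T fun k => if k ∈ insert a s ∨ k = o then halfProj b (Z k) else 1) =
          Q * hT.emb a (halfProj b (Z a)) := by
        rw [hT.emb_apply, hQ, ← hT.map_mul]
        congr 1
        ext k
        by_cases hk : k = a
        · subst hk; simp [ha, hoa.symm]
        · simp [hk, Finset.mem_insert]
      have e2 : Q = Q' * hT.emb o (halfProj b (Z o)) := by
        rw [hT.emb_apply, hQ, hQ', ← hT.map_mul]
        congr 1
        ext k
        by_cases hk : k = o
        · subst hk; simp [hos]
        · simp [hk]
      have e3 : Q * hT.emb a (halfProj b (Z a)) - hT.emb o (halfProj b (Z o)) =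
          Q * (hT.emb a (halfProj b (Z a)) - hT.emb o (halfProj b (Z o))) +
          Q' * (hT.emb o (halfProj b (Z o)) * hT.emb o (halfProj b (Z o)) -
            hT.emb o (halfProj b (Z o))) + (Q - hT.emb o (halfProj b (Z o))) := by
        rw [e2]; noncomm_ring
      rw [e1, e3, Finset.card_insert_of_notMem ha]
      have a1 := hPos.gnsNorm_add_le
        (Q * (hT.emb a (halfProj b (Z a)) - hT.emb o (halfProj b (Z o))) +
          Q' * (hT.emb o (halfProj b (Z o)) * hT.emb o (halfProj b (Z o)) -
            hT.emb o (halfProj b (Z o)))) (Q - hT.emb o (halfProj b (Z o)))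
      have a2 := hPos.gnsNorm_add_le
        (Q * (hT.emb a (halfProj b (Z a)) - hT.emb o (halfProj b (Z o))))
        (Q' * (hT.emb o (halfProj b (Z o)) * hT.emb o (halfProj b (Z o)) -
            hT.emb o (halfProj b (Z o))))
      have a3 := cQ.gnsNorm_mul_le hPos
        (hT.emb a (halfProj b (Z a)) - hT.emb o (halfProj b (Z o)))
      have a4 := cQ'.gnsNorm_mul_le hPos
        (hT.emb o (halfProj b (Z o)) * hT.emb o (halfProj b (Z o)) - hT.emb o (halfProj b (Z o)))
      have a5 := h1 a
      push_cast
      linarith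
  have hfin := key (Finset.univ.erase o) (by simp)
  have e : (T fun k => if k ∈ Finset.univ.erase o ∨ k = o then halfProj b (Z k) else 1) =
      T fun k => halfProj b (Z k) := by
    congr 1
    ext k
    have : k ∈ Finset.univ.erase o ∨ k = o := by simp [em']
    rw [if_pos this]
  rw [e] at hfin
  refine hfin.trans ?_
  have : ((Finset.univ.erase o).card : ℝ) ≤ Fintype.card ι := by
    exact_mod_cast Finset.card_le_univ _
  gcongr

include hX

/-- Both tensor projections reduce to projections at `o`, which sum to `1`, and `⨂ X` acts nearly as
`1`. -/
theorem gnsNorm_ghzProj_sub_one_le :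
    gnsNorm φ (ghzProj T X Z - 1) ≤ 11 * Fintype.card ι * η := by
  have hPos := h.toIsPositiveFunctional
  have hη : 0 ≤ η := by have := (gnsNorm_nonneg _ _).trans hN.prod_X; linarith
  have hfac : ∀ a b, (T fun k => ghzFactor (X k) (Z k) (a, b)) =
      (if a then T X else 1) * T fun k => halfProj b (Z k) := by
    intro a b
    cases a
    · simp [ghzFactor]
    · simp only [ghzFactor, if_true]
      rw [← hT.map_mul]; rfl
  have e1 : ∀ b, hT.emb o (halfProj b (Z o)) = halfProj b (hT.emb o (Z o)) := by
    intro b; simp [halfProj]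
  set Q : Bool → A := fun b => T fun k => halfProj b (Z k) with hQ
  have e2 : ghzProj T X Z - 1 = (1 / 2 : ℝ) • (1 + T X) *
      ((Q false - hT.emb o (halfProj false (Z o))) + (Q true - hT.emb o (halfProj true (Z o)))) +
      (1 / 2 : ℝ) • (T X - 1) := by
    have e3 : hT.emb o (halfProj false (Z o)) + hT.emb o (halfProj true (Z o)) = 1 := by
      rw [e1, e1]; simp only [halfProj, bitSign]; simp only [Bool.false_eq_true, if_false, if_true]
      module
    have e4 : (Q false - hT.emb o (halfProj false (Z o))) +
        (Q true - hT.emb o (halfProj true (Z o))) = Q false + Q true - 1 := by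
      rw [← e3]; abel
    rw [e4, ghzProj]
    simp only [Fintype.sum_prod_type, Fintype.sum_bool, hfac, if_true, Bool.false_eq_true, if_false,
      one_mul, smul_mul_assoc, add_mul, mul_sub, mul_add, mul_one]
    module
  have hc : IsContraction ((1 / 2 : ℝ) • (1 + T X)) :=
    IsContraction.one.half_add (hT.isContraction fun k => (hX k).contr)
  rw [e2]
  have a1 := hPos.gnsNorm_add_le ((1 / 2 : ℝ) • (1 + T X) *
      ((Q false - hT.emb o (halfProj false (Z o))) + (Q true - hT.emb o (halfProj true (Z o)))))
      ((1 / 2 : ℝ) • (T X - 1))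
  have a2 := hc.gnsNorm_mul_le hPos
    ((Q false - hT.emb o (halfProj false (Z o))) + (Q true - hT.emb o (halfProj true (Z o))))
  have a3 := hPos.gnsNorm_add_le (Q false - hT.emb o (halfProj false (Z o)))
    (Q true - hT.emb o (halfProj true (Z o)))
  have a4 := gnsNorm_prod_halfProj_sub_le hT hZ h hN false
  have a5 := gnsNorm_prod_halfProj_sub_le hT hZ h hN true
  have a6 := hN.prod_X
  rw [IsPositiveFunctional.gnsNorm_smul (c := 1 / 2) (x := T X - 1),
    abs_of_pos (by norm_num)] at a1
  have : (1 : ℝ) ≤ Fintype.card ι := by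
    exact_mod_cast Fintype.card_pos_iff.2 ⟨o⟩
  nlinarith

/-- Compression by the approximate GHZ projection barely changes expectation values. -/
theorem abs_conj_ghzProj_sub_le (hsmall : 11 * Fintype.card ι * η ≤ 1) {g : A}
    (hg : IsContraction g) :
    |φ (star (ghzProj T X Z) * g * ghzProj T X Z) - φ g| ≤ 33 * Fintype.card ι * η := by
  have hPos := h.toIsPositiveFunctional
  have h1 := gnsNorm_ghzProj_sub_one_le hT hX hZ h hN
  set S := ghzProj T X Z
  -- `S` is not shown to be a contraction; smallness of `η` gives this cruder bound, and `33 = 11 (2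
  -- + 1)`.
  have hS : gnsNorm φ S ≤ 2 := by
    have a1 := hPos.gnsNorm_add_le (S - 1) 1
    have a2 := (IsContraction.one (A := A)).gnsNorm_le_one h
    rw [sub_add_cancel] at a1
    linarith
  have e : φ (star S * g * S) - φ g = φ (star S * (g * (S - 1))) + φ (star (S - 1) * g) := by
    rw [← map_sub, ← map_add]
    congr 1
    simp only [star_sub, star_one]
    noncomm_ring
  rw [e]
  refine (abs_add_le _ _).trans ?_
  have b1 := hPos.abs_star_mul_le S (g * (S - 1))
  have b2 := hg.abs_mul_star_le h (S - 1)
  have b3 := hg.gnsNorm_mul_le hPos (S - 1)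
  have b4 := gnsNorm_nonneg φ (g * (S - 1))
  have b5 := gnsNorm_nonneg φ S
  nlinarith

omit hZ in
/-- A correlator with `Y` at two sites and `X` at the others reduces to a two-body correlator. -/
theorem abs_correlator_sub_le {Y : ∀ k, 𝒜 k} (hY : ∀ k, IsObservable (Y k)) {i j : ι}
    (hij : i ≠ j) :
    |φ (T fun k => if k = i ∨ k = j then Y k else X k) -
      φ (hT.emb i (Y i * X i) * hT.emb j (Y j * X j))| ≤ 23 * η := by
  have hPos := h.toIsPositiveFunctional
  set r := T fun k => if k = i ∨ k = j then 1 else X k with hr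
  set x := fun k => hT.emb k (X k) with hx
  have hxo : ∀ k, IsObservable (x k) := fun k => (hX k).map (hT.emb k)
  set y := hT.emb i (Y i) * hT.emb j (Y j) with hy
  have cy : IsContraction (star y) := by
    rw [hy, star_mul, ((hY i).map _).star_eq, ((hY j).map _).star_eq]
    exact ((hY j).map _).contr.mul ((hY i).map _).contr
  have cr : IsContraction r := hT.isContraction fun k => by
    split_ifs
    exacts [.one, (hX k).contr]
  have e1 : (T fun k => if k = i ∨ k = j then Y k else X k) = y * r := by
    rw [hy, hr, hT.emb_apply, hT.emb_apply, ← hT.map_mul, ← hT.map_mul]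
    congr 1
    ext k
    by_cases hi : k = i
    · subst hi; simp [Pi.mulSingle_eq_of_ne hij]
    · by_cases hj : k = j
      · subst hj; simp [hi]
      · simp [hi, hj]
  have cxy : Commute (x i) (hT.emb j (Y j)) := hT.commute_emb hij _ _
  have e2 : hT.emb i (Y i * X i) * hT.emb j (Y j * X j) = y * (x i * x j) := by
    simp only [map_mul, hy, mul_assoc]
    rw [show hT.emb i (X i) * (hT.emb j (Y j) * hT.emb j (X j)) =
      hT.emb j (Y j) * (hT.emb i (X i) * hT.emb j (X j)) from cxy.left_comm _]
  have e3 : T X = r * (x i * x j) := by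
    rw [hr, hx]
    simp only [hT.emb_apply]
    rw [← hT.map_mul, ← hT.map_mul]
    congr 1
    ext k
    by_cases hi : k = i
    · subst hi; simp [Pi.mulSingle_eq_of_ne hij]
    · by_cases hj : k = j
      · subst hj; simp [hi]
      · simp [hi, hj]
  have ci : Commute (x i) r := hT.commute_emb_of_eq_one _ (by simp)
  have cj : Commute (x j) r := hT.commute_emb_of_eq_one _ (by simp)
  have cij : Commute (x i) (x j) := hT.commute_emb hij _ _
  -- Since `T X = r xᵢ xⱼ ≈ 1` and the squares are nearly `1`, the remaining `X`'s act as `xᵢ xⱼ`;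
  -- the cost is `5 + 9 + 9 = 23`.
  have e4 : r - x i * x j = x i * x j * (T X - 1) -
      r * (x i * x i * (x j * x j - 1) + (x i * x i - 1)) := by
    rw [e3]
    have : x i * x j * (r * (x i * x j)) = r * (x i * x i * (x j * x j)) := by
      rw [← mul_assoc, (ci.mul_left cj).eq, mul_assoc, cij.mul_mul_mul_comm]
    rw [mul_sub, this]
    noncomm_ring
  rw [e1, e2, ← map_sub, ← mul_sub]
  have b0 := cy.abs_star_mul_le h (r - x i * x j)
  rw [star_star] at b0
  refine b0.trans ?_
  rw [e4]
  have a1 := hPos.gnsNorm_sub_le (x i * x j * (T X - 1))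
    (r * (x i * x i * (x j * x j - 1) + (x i * x i - 1)))
  have a2 := ((hxo i).contr.mul (hxo j).contr).gnsNorm_mul_le hPos (T X - 1)
  have a3 := cr.gnsNorm_mul_le hPos (x i * x i * (x j * x j - 1) + (x i * x i - 1))
  have a4 := hPos.gnsNorm_add_le (x i * x i * (x j * x j - 1)) (x i * x i - 1)
  have a5 := ((hxo i).contr.mul (hxo i).contr).gnsNorm_mul_le hPos (x j * x j - 1)
  have a6 := hN.prod_X
  have a7 := hN.X_sq i
  have a8 := hN.X_sq j
  linarith

end Stabilized

end GHZProjection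

/-! ### Bounding the two-body correlators through the product state -/

section MerminBound

variable {ι : Type*} [Fintype ι] [DecidableEq ι] {𝒜 : ι → Type*} [∀ i, Ring (𝒜 i)]
  [∀ i, Algebra ℝ (𝒜 i)] [∀ i, StarRing (𝒜 i)] [∀ i, StarModule ℝ (𝒜 i)]
  {A : Type*} [Ring A] [Algebra ℝ A] [StarRing A] [StarModule ℝ A]

theorem mul_apply_le_of_mem_sqCone {φ ρ : A →ₗ[ℝ] ℝ} {P : ℝ}
    (hdom : ∀ y, P * φ (star y * y) ≤ ρ (star y * y)) {x : A} (hx : x ∈ sqCone A) :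
    P * φ x ≤ ρ x := by
  induction hx using AddSubmonoid.closure_induction with
  | mem x hx => obtain ⟨r, rfl⟩ := hx; exact hdom r
  | zero => simp
  | add a b _ _ ha hb => rw [map_add, map_add, mul_add]; exact add_le_add ha hb

/-- For skew `kᵢ`, the square `(∑ kᵢ)⋆(∑ kᵢ)` is `-∑ kᵢ²` minus the off-diagonal sum, and `n + ∑
kᵢ²` is the sum of the `1 - kᵢ⋆kᵢ`. -/
theorem sub_sum_offDiag_mem_sqCone {k : ι → A} (sk : ∀ i, star (k i) = -k i)
    (ck : ∀ i, IsContraction (k i)) :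
    (Fintype.card ι : ℝ) • (1 : A) - ∑ p ∈ Finset.univ.offDiag, k p.1 * k p.2 ∈ sqCone A := by
  have h1 := star_mul_self_mem_sqCone (∑ i, k i)
  have h2 : ∑ i, (1 - star (k i) * k i) ∈ sqCone A := sum_mem fun i _ => ck i
  convert add_mem h1 h2 using 1
  simp only [star_sum, sk, Finset.sum_neg_distrib, neg_mul, sub_neg_eq_add]
  rw [sum_mul_sum_eq_diag_add_offDiag, Finset.sum_add_distrib, Finset.sum_const, Finset.card_univ,
    Nat.cast_smul_eq_nsmul]
  abel

/-- The two-body correlators of the `dᵢ` are controlled by their skew parts. -/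
theorem neg_sum_offDiag_le {φ : A →ₗ[ℝ] ℝ} (h : IsState φ) {d : ι → A}
    (hd : ∀ i, IsContraction (d i)) (hd' : ∀ i, IsContraction (star (d i)))
    (hc : ∀ i j, i ≠ j → Commute (star (d i)) (star (d j))) :
    -∑ p ∈ Finset.univ.offDiag, φ (d p.1 * d p.2) ≤
      φ ((Fintype.card ι : ℝ) • (1 : A) - ∑ p ∈ Finset.univ.offDiag,
        ((1 / 2 : ℝ) • (d p.1 - star (d p.1))) * ((1 / 2 : ℝ) • (d p.2 - star (d p.2)))) := by
  set w : ι → A := fun i => (1 / 2 : ℝ) • (d i + star (d i)) with hw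
  have sw : ∀ i, star (w i) = w i := by intro i; simp [hw, add_comm]
  have cw : ∀ i, IsContraction (w i) := fun i => (hd i).half_add (hd' i)
  have hW := h.nonneg (∑ i, w i)
  rw [star_sum, Finset.sum_congr rfl fun i _ => sw i, sum_mul_sum_eq_diag_add_offDiag, map_add,
    map_sum, map_sum] at hW
  have hle : ∑ i, φ (w i * w i) ≤ Fintype.card ι := by
    rw [← Finset.card_univ, ← nsmul_one, ← Finset.sum_const]
    refine Finset.sum_le_sum fun i _ => ?_
    have := h.nonneg_of_mem (cw i)
    rw [map_sub, h.map_one, sw] at this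
    linarith
  -- Reality gives `φ(dᵢ dⱼ) = φ(dᵢ⋆ dⱼ⋆)`, so averaging the two removes the mixed symmetric-skew
  -- terms.
  have hpair : ∀ p ∈ Finset.univ.offDiag, φ (d p.1 * d p.2) = φ (w p.1 * w p.2) +
      φ (((1 / 2 : ℝ) • (d p.1 - star (d p.1))) * ((1 / 2 : ℝ) • (d p.2 - star (d p.2)))) := by
    intro p hp
    have hp' : p.1 ≠ p.2 := by simpa using hp
    have e1 := h.map_star (d p.1 * d p.2)
    rw [star_mul, (hc _ _ hp'.symm).eq] at e1
    have e2 : w p.1 * w p.2 +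
        ((1 / 2 : ℝ) • (d p.1 - star (d p.1))) * ((1 / 2 : ℝ) • (d p.2 - star (d p.2))) =
        (1 / 2 : ℝ) • (d p.1 * d p.2 + star (d p.1) * star (d p.2)) := by
      simp only [hw, smul_mul_assoc, mul_smul_comm, add_mul, mul_add, sub_mul, mul_sub]
      module
    rw [← map_add, e2, map_smul, map_add, e1, smul_eq_mul]
    ring
  rw [Finset.sum_congr rfl hpair, Finset.sum_add_distrib, map_sub, map_smul, h.map_one, map_sum,
    smul_eq_mul, mul_one]
  linarith

theorem one_add_pow_le {x : ℝ} (hx : 0 ≤ x) {n : ℕ} (h : n * x ≤ 1) :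
    (1 + x) ^ n ≤ 1 + 2 * (n * x) := by
  have h1 : (1 + x) ^ n ≤ Real.exp (n * x) := by
    rw [mul_comm, Real.exp_mul, Real.rpow_natCast]
    exact pow_le_pow_left₀ (by linarith) (by linarith [Real.add_one_le_exp x]) n
  have h2 := Real.abs_exp_sub_one_le (x := n * x) (by rw [abs_of_nonneg (by positivity)]; exact h)
  rw [abs_of_nonneg (a := (n : ℝ) * x) (by positivity)] at h2
  linarith [(abs_le.1 h2).2]

/-- The witness is `g = φ(G)`. Positivity of `G` allows `P φ ≤ ρ` to be applied to `S⋆GS`, where `φ`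
hardly notices `S` and `ρ` can be computed factor by factor. -/
theorem mermin_bound {T : MultilinearMap ℝ 𝒜 A} (hT : IsStarTensor T) {X Y Z : ∀ k, 𝒜 k}
    (hX : ∀ k, IsObservable (X k)) (hY : ∀ k, IsObservable (Y k)) (hZ : ∀ k, IsObservable (Z k))
    {η : ℝ} {ρ : A →ₗ[ℝ] ℝ} {e : ∀ k, 𝒜 k →ₗ[ℝ] ℝ} (hρ : ∀ O, ρ (T O) = ∏ k, e k (O k))
    (he : ∀ k, IsState (e k)) (hP : ∀ k, IsApproxPauli (e k) (X k) (Z k) η)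
    {φ : A →ₗ[ℝ] ℝ} (h : IsState φ) {o : ι} (hN : IsNearGHZ hT φ o X Z η)
    {P : ℝ} (hP0 : 0 ≤ P) (hdom : ∀ y, P * φ (star y * y) ≤ ρ (star y * y))
    (hcard : 3 ≤ Fintype.card ι) (hsmall : 54 * Fintype.card ι * η ≤ 1) :
    ∃ g : ℝ, -∑ p ∈ Finset.univ.offDiag, φ (T fun k => if k = p.1 ∨ k = p.2 then Y k else X k) ≤
        g + 23 * (Fintype.card ι : ℝ) ^ 2 * η ∧
      2 ^ Fintype.card ι * P * (g - 33 * (Fintype.card ι : ℝ) ^ 3 * η) ≤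
        Fintype.card ι + 754 * (Fintype.card ι : ℝ) ^ 2 * η := by
  have hη : 0 ≤ η := by have := (gnsNorm_nonneg _ _).trans hN.prod_X; linarith
  set n := Fintype.card ι with hn
  have hn3 : (3 : ℝ) ≤ n := by exact_mod_cast hcard
  set d : ∀ k, 𝒜 k := fun k => Y k * X k with hd
  have cd : ∀ k, IsContraction (d k) := fun k => (hY k).contr.mul (hX k).contr
  have cd' : ∀ k, IsContraction (star (d k)) := fun k => by
    simp only [hd, star_mul, (hX k).star_eq, (hY k).star_eq]
    exact (hX k).contr.mul (hY k).contr
  set K : ∀ k, 𝒜 k := fun k => (1 / 2 : ℝ) • (d k - star (d k)) with hK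
  have cK : ∀ k, IsContraction (K k) := fun k => (cd k).half_sub (cd' k)
  have sK : ∀ k, star (K k) = -K k := fun k => by
    simp only [hK, star_smul, star_sub, star_star, star_trivial]
    module
  set G : A := (n : ℝ) • (1 : A) -
    ∑ p ∈ Finset.univ.offDiag, hT.emb p.1 (K p.1) * hT.emb p.2 (K p.2) with hG
  have hGmem : G ∈ sqCone A := sub_sum_offDiag_mem_sqCone (k := fun i => hT.emb i (K i))
    (fun i => by rw [← map_star, sK, map_neg]) (fun i => (cK i).map _)
  have hcardOff : ((Finset.univ : Finset ι).offDiag.card : ℝ) ≤ (n : ℝ) ^ 2 - n := by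
    rw [Finset.offDiag_card, Finset.card_univ, ← hn, Nat.cast_sub (Nat.le_mul_self n)]
    push_cast
    linarith
  refine ⟨φ G, ?_, ?_⟩
  · have h1 := neg_sum_offDiag_le h (d := fun i => hT.emb i (d i)) (fun i => (cd i).map _)
      (fun i => by rw [← map_star]; exact (cd' i).map _)
      (fun i j hij => by rw [← map_star, ← map_star]; exact hT.commute_emb hij _ _)
    have e1 : (n : ℝ) • (1 : A) - ∑ p ∈ Finset.univ.offDiag,
        ((1 / 2 : ℝ) • (hT.emb p.1 (d p.1) - star (hT.emb p.1 (d p.1)))) *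
          ((1 / 2 : ℝ) • (hT.emb p.2 (d p.2) - star (hT.emb p.2 (d p.2)))) = G := by
      simp only [hG, hK, ← map_star, ← map_sub, ← map_smul]
    rw [e1] at h1
    have h2 : ∑ p ∈ Finset.univ.offDiag, φ (hT.emb p.1 (d p.1) * hT.emb p.2 (d p.2)) -
        ∑ p ∈ Finset.univ.offDiag, φ (T fun k => if k = p.1 ∨ k = p.2 then Y k else X k) ≤
        ∑ p ∈ (Finset.univ : Finset ι).offDiag, 23 * η := by
      rw [← Finset.sum_sub_distrib]
      refine Finset.sum_le_sum fun p hp => ?_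
      have := abs_le.1 (abs_correlator_sub_le hT hX h hN hY (i := p.1) (j := p.2)
        (by simpa using hp))
      linarith
    rw [Finset.sum_const, nsmul_eq_mul] at h2
    nlinarith
  · have h1 := mul_apply_le_of_mem_sqCone hdom (conj_mem_sqCone hGmem (ghzProj T X Z))
    have expand : ∀ ψ : A →ₗ[ℝ] ℝ, ψ (star (ghzProj T X Z) * G * ghzProj T X Z) =
        n * ψ (star (ghzProj T X Z) * ghzProj T X Z) - ∑ p ∈ Finset.univ.offDiag,
          ψ (star (ghzProj T X Z) * (hT.emb p.1 (K p.1) * hT.emb p.2 (K p.2)) *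
            ghzProj T X Z) := by
      intro ψ
      simp only [hG, mul_sub, sub_mul, Finset.mul_sum, Finset.sum_mul, mul_smul_comm,
        smul_mul_assoc, mul_one, map_sub, map_smul, map_sum, smul_eq_mul]
    -- Each of the `n` units and of the `n² - n` pairs costs `33 n η`, in total `33 n³ η`.
    have hlow : φ G - 33 * (n : ℝ) ^ 3 * η ≤
        φ (star (ghzProj T X Z) * G * ghzProj T X Z) := by
      rw [expand φ, hG, map_sub, map_smul, map_sum, smul_eq_mul]
      have hs : 11 * (n : ℝ) * η ≤ 1 := by nlinarith
      have b1 := abs_le.1 (abs_conj_ghzProj_sub_le hT hX hZ h hN hs IsContraction.one)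
      rw [mul_one] at b1
      have b2 : ∑ p ∈ Finset.univ.offDiag, φ (star (ghzProj T X Z) *
            (hT.emb p.1 (K p.1) * hT.emb p.2 (K p.2)) * ghzProj T X Z) -
          ∑ p ∈ Finset.univ.offDiag, φ (hT.emb p.1 (K p.1) * hT.emb p.2 (K p.2)) ≤
          ∑ p ∈ (Finset.univ : Finset ι).offDiag, 33 * n * η := by
        rw [← Finset.sum_sub_distrib]
        refine Finset.sum_le_sum fun p _ => ?_
        exact (abs_le.1 (abs_conj_ghzProj_sub_le hT hX hZ h hN hs
          (((cK p.1).map _).mul ((cK p.2).map _)))).2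
      rw [Finset.sum_const, nsmul_eq_mul] at b2
      have b3 : (n : ℝ) * (φ 1 - φ (star (ghzProj T X Z) * ghzProj T X Z)) ≤ n * (33 * n * η) :=
        mul_le_mul_of_nonneg_left (by linarith) (by linarith)
      have b4 : ((Finset.univ : Finset ι).offDiag.card : ℝ) * (33 * n * η) ≤
          ((n : ℝ) ^ 2 - n) * (33 * n * η) :=
        mul_le_mul_of_nonneg_right hcardOff (by positivity)
      nlinarith
    have hup : 2 ^ n * ρ (star (ghzProj T X Z) * G * ghzProj T X Z) ≤
        n + 754 * (n : ℝ) ^ 2 * η := by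
      rw [expand ρ]
      have c1 := product_ghzProj_sq_le hT hX hZ hρ he hP
      have c2 : -∑ p ∈ Finset.univ.offDiag, ρ (star (ghzProj T X Z) *
          (hT.emb p.1 (K p.1) * hT.emb p.2 (K p.2)) * ghzProj T X Z) ≤
          ∑ p ∈ (Finset.univ : Finset ι).offDiag, 3 * (27 * η) ^ (n - 2) := by
        rw [← Finset.sum_neg_distrib]
        refine Finset.sum_le_sum fun p hp => ?_
        exact neg_le.1 (abs_le.1 (abs_product_conj_skew_le hT hX hZ hρ he hP
          (by simpa using hp) (sK p.1) (cK p.1) (cK p.2))).1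
      rw [Finset.sum_const, nsmul_eq_mul] at c2
      have h54 : 54 * η ≤ 1 := by nlinarith
      have d1 : (2 : ℝ) ^ n * ((1 / 2 + 13 * η) ^ n + 3 * (27 * η) ^ n) ≤
          1 + 52 * n * η + 162 * η := by
        have f1 : (2 : ℝ) ^ n * (1 / 2 + 13 * η) ^ n = (1 + 26 * η) ^ n := by
          rw [← mul_pow]; congr 1; ring
        have f2 : (2 : ℝ) ^ n * (27 * η) ^ n = (54 * η) ^ n := by
          rw [← mul_pow]; congr 1; ring
        have f3 := one_add_pow_le (x := 26 * η) (by positivity) (n := n) (by nlinarith)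
        have f4 : (54 * η) ^ n ≤ 54 * η :=
          pow_le_of_le_one (by positivity) h54 (by omega)
        rw [mul_add, f1, mul_left_comm, f2]
        linarith
      -- The factor `2^n` is absorbed as `4 (54η)^(n-2)`. A positive exponent is needed here, which
      -- is why `n = 2` is excluded.
      have d2 : (2 : ℝ) ^ n * (3 * (27 * η) ^ (n - 2)) ≤ 648 * η := by
        have f1 : (2 : ℝ) ^ n = 4 * 2 ^ (n - 2) := by
          calc (2 : ℝ) ^ n = 2 ^ (2 + (n - 2)) := by congr 1; omega
            _ = 4 * 2 ^ (n - 2) := by rw [pow_add]; norm_num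
        have f2 : (2 : ℝ) ^ (n - 2) * (27 * η) ^ (n - 2) = (54 * η) ^ (n - 2) := by
          rw [← mul_pow]; congr 1; ring
        have f4 : (54 * η) ^ (n - 2) ≤ 54 * η :=
          pow_le_of_le_one (by positivity) h54 (by omega)
        rw [f1]
        linarith
      have d3 : (2 : ℝ) ^ n * ρ (star (ghzProj T X Z) * ghzProj T X Z) ≤
          1 + 52 * n * η + 162 * η :=
        (mul_le_mul_of_nonneg_left c1 (by positivity)).trans d1
      have d4 : (2 : ℝ) ^ n * -∑ p ∈ Finset.univ.offDiag, ρ (star (ghzProj T X Z) *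
          (hT.emb p.1 (K p.1) * hT.emb p.2 (K p.2)) * ghzProj T X Z) ≤
          ((n : ℝ) ^ 2 - n) * (648 * η) := by
        refine (mul_le_mul_of_nonneg_left c2 (by positivity)).trans ?_
        rw [mul_left_comm]
        exact mul_le_mul hcardOff d2 (by positivity) (by nlinarith)
      have d5 : (n : ℝ) * (2 ^ n * ρ (star (ghzProj T X Z) * ghzProj T X Z)) ≤
          n * (1 + 52 * n * η + 162 * η) := mul_le_mul_of_nonneg_left d3 (by positivity)
      nlinarith
    have h2 : P * (φ G - 33 * (n : ℝ) ^ 3 * η) ≤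
        P * φ (star (ghzProj T X Z) * G * ghzProj T X Z) := mul_le_mul_of_nonneg_left hlow hP0
    have h3 := mul_le_mul_of_nonneg_left (h2.trans h1) (by positivity : (0 : ℝ) ≤ 2 ^ n)
    rw [mul_assoc]
    exact h3.trans hup

end MerminBound

/-! ### Real matrices as a model of the abstract setting -/

section MatrixTensor

variable {N : ℕ}

/-- `localTensor` as a multilinear map. -/
noncomputable def localTensorMap (d : Fin N → ℕ) :
    MultilinearMap ℝ (fun i => Matrix (Fin (d i)) (Fin (d i)) ℝ)
      (Matrix (∀ i, Fin (d i)) (∀ i, Fin (d i)) ℝ) where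
  toFun := localTensor
  map_update_add' O k x y := by
    ext a a'
    have := ((MultilinearMap.mkPiAlgebra ℝ (Fin N) ℝ).compLinearMap
      fun i => Matrix.entryLinearMap ℝ ℝ (a i) (a' i)).map_update_add O k x y
    simp only [MultilinearMap.compLinearMap_apply, MultilinearMap.mkPiAlgebra_apply,
      Matrix.entryLinearMap_apply] at this
    simpa only [localTensor, Matrix.of_apply, Matrix.add_apply, Matrix.smul_apply] using this
  map_update_smul' O k c x := by
    ext a a'
    have := ((MultilinearMap.mkPiAlgebra ℝ (Fin N) ℝ).compLinearMap
      fun i => Matrix.entryLinearMap ℝ ℝ (a i) (a' i)).map_update_smul O k c x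
    simp only [MultilinearMap.compLinearMap_apply, MultilinearMap.mkPiAlgebra_apply,
      Matrix.entryLinearMap_apply] at this
    simpa only [localTensor, Matrix.of_apply, Matrix.add_apply, Matrix.smul_apply] using this

theorem localTensorMap_apply {d : Fin N → ℕ} (O : ∀ i, Matrix (Fin (d i)) (Fin (d i)) ℝ) :
    localTensorMap d O = localTensor O := rfl

theorem isStarTensor_localTensorMap (d : Fin N → ℕ) : IsStarTensor (localTensorMap d) where
  map_one := by
    ext a a'
    simp only [localTensorMap_apply, localTensor, Matrix.of_apply, Pi.one_apply, Matrix.one_apply,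
      Finset.prod_ite_zero, Finset.prod_const_one, Finset.mem_univ, true_implies, funext_iff]
  map_mul O O' := by
    ext a a'
    simp only [localTensorMap_apply, localTensor, Matrix.of_apply, Pi.mul_apply, Matrix.mul_apply,
      Finset.prod_univ_sum, Fintype.piFinset_univ, Finset.prod_mul_distrib]
  map_star O := by
    ext a a'
    simp [localTensorMap_apply, localTensor]

theorem sum_prod_pi {α β : Fin N → Type*} [∀ i, Fintype (α i)] [∀ i, Fintype (β i)]
    (f : ∀ i, α i → β i → ℝ) :
    ∑ p : (∀ i, α i) × (∀ i, β i), ∏ i, f i (p.1 i) (p.2 i) =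
      ∏ i, ∑ x : α i × β i, f i x.1 x.2 := by
  rw [Finset.prod_univ_sum, Fintype.piFinset_univ]
  exact Finset.sum_nbij' (fun p i => (p.1 i, p.2 i)) (fun x => (fun i => (x i).1, fun i => (x i).2))
    (by simp) (by simp) (by simp) (by simp) (by simp)

open scoped MatrixOrder Matrix.Norms.L2Operator in
theorem exists_eq_conjTranspose_mul_self {n : Type*} [Fintype n] [DecidableEq n]
    {B : Matrix n n ℝ} (hB : B.PosSemidef) : ∃ r : Matrix n n ℝ, B = r.conjTranspose * r :=
  CStarAlgebra.nonneg_iff_eq_star_mul_self.mp hB.nonneg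

theorem posSemidef_trace_mul_nonneg {n : Type*} [Fintype n] [DecidableEq n] {B C : Matrix n n ℝ}
    (hB : B.PosSemidef) (hC : C.PosSemidef) : 0 ≤ (B * C).trace := by
  obtain ⟨r, rfl⟩ := exists_eq_conjTranspose_mul_self hC
  rw [← Matrix.mul_assoc, Matrix.trace_mul_comm, ← Matrix.mul_assoc]
  exact (hB.mul_mul_conjTranspose_same r).trace_nonneg

variable {m n : Type*} [Fintype m] [DecidableEq m] [Fintype n] [DecidableEq n]

/-- The functional `O ↦ Tr[(O ⊗ R) τ]`. -/
noncomputable def traceFunctional (R : Matrix n n ℝ) (τ : Matrix (m × n) (m × n) ℝ) :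
    Matrix m m ℝ →ₗ[ℝ] ℝ where
  toFun O := ((O ⊗ₖ R) * τ).trace
  map_add' x y := by rw [Matrix.add_kronecker, add_mul, Matrix.trace_add]
  map_smul' c x := by
    rw [Matrix.smul_kronecker, smul_mul_assoc, Matrix.trace_smul, RingHom.id_apply]

theorem traceFunctional_apply (R : Matrix n n ℝ) (τ : Matrix (m × n) (m × n) ℝ)
    (O : Matrix m m ℝ) : traceFunctional R τ O = ((O ⊗ₖ R) * τ).trace := rfl

theorem isPositiveFunctional_traceFunctional {R : Matrix n n ℝ} {τ : Matrix (m × n) (m × n) ℝ}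
    (hR : R.PosSemidef) (hτ : τ.PosSemidef) : IsPositiveFunctional (traceFunctional R τ) where
  map_star x := by
    rw [traceFunctional_apply, traceFunctional_apply, Matrix.trace_mul_comm,
      ← Matrix.trace_transpose, Matrix.transpose_mul]
    have h1 : τ.transpose = τ := by simpa using hτ.isHermitian.eq
    have h2 : R.transpose = R := by simpa using hR.isHermitian.eq
    rw [h1, ← Matrix.kroneckerMap_transpose, h2, Matrix.star_eq_conjTranspose,
      Matrix.conjTranspose_eq_transpose_of_trivial, Matrix.transpose_transpose]
  nonneg x :=
    posSemidef_trace_mul_nonneg ((Matrix.posSemidef_conjTranspose_mul_self x).kronecker hR) hτ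

theorem posSemidef_mem_sqCone {B : Matrix n n ℝ} (hB : B.PosSemidef) : B ∈ sqCone (Matrix n n ℝ) := by
  obtain ⟨r, rfl⟩ := exists_eq_conjTranspose_mul_self hB
  exact star_mul_self_mem_sqCone r

/-- The difference of the two effects of a two-outcome measurement is an observable. -/
theorem isObservable_effect_sub {B C : Matrix n n ℝ} (hB : B.PosSemidef) (hC : C.PosSemidef)
    (h : B + C = 1) : IsObservable (B - C) := by
  have sB : star B = B := hB.isHermitian.eq
  have sC : star C = C := hC.isHermitian.eq
  refine ⟨by rw [star_sub, sB, sC], ?_⟩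
  -- As `B` and `C = 1 - B` commute, `1 - (B - C)² = 4BC = 4(BCB + CBC)`.
  have h1 := conj_mem_sqCone (posSemidef_mem_sqCone hC) B
  have h2 := conj_mem_sqCone (posSemidef_mem_sqCone hB) C
  have h3 := smul_mem_sqCone (add_mem h1 h2) (by norm_num : (0 : ℝ) ≤ 4)
  unfold IsContraction
  convert h3 using 1
  have hC' : C = 1 - B := by rw [← h]; abel
  rw [star_sub, sB, sC, hC']
  simp only [sub_mul, mul_sub, mul_one, one_mul]
  module

end MatrixTensor

/-! ### Conditional states and marginals of the star network -/

namespace RealStarNetwork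

variable {N : ℕ} (S : RealStarNetwork N)

theorem isObservable_obs (i : Fin N) (x : Fin 3) : IsObservable (S.obs i x) :=
  isObservable_effect_sub (S.M_pos i x 0) (S.M_pos i x 1) (by
    have := S.M_sum i x
    rwa [Fin.sum_univ_two] at this)

theorem posSemidef_jointState : S.jointState.PosSemidef := by
  choose r hr using fun i => exists_eq_conjTranspose_mul_self (S.ρ_pos i)
  let C : Matrix ((∀ i, Fin (S.dA i)) × (∀ i, Fin (S.dE i)))
      ((∀ i, Fin (S.dA i)) × (∀ i, Fin (S.dE i))) ℝ :=
    Matrix.of fun p q => ∏ i, r i (p.1 i, p.2 i) (q.1 i, q.2 i)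
  have : S.jointState = C.conjTranspose * C := by
    ext p q
    simp only [jointState, C, Matrix.of_apply, Matrix.mul_apply, Matrix.conjTranspose_apply,
      star_trivial, ← Finset.prod_mul_distrib]
    rw [sum_prod_pi fun i a b => r i (a, b) (p.1 i, p.2 i) * r i (a, b) (q.1 i, q.2 i)]
    refine Finset.prod_congr rfl fun i _ => ?_
    rw [hr i, Matrix.mul_apply]
    rfl
  rw [this]
  exact Matrix.posSemidef_conjTranspose_mul_self C

/-- The unnormalised state of the external parties for Eve's outcome `l`. -/
noncomputable def outcomeFunctional (l : Fin N → Bool) :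
    Matrix (∀ i, Fin (S.dA i)) (∀ i, Fin (S.dA i)) ℝ →ₗ[ℝ] ℝ :=
  traceFunctional (S.R l) S.jointState

theorem isPositiveFunctional_outcomeFunctional (l : Fin N → Bool) :
    IsPositiveFunctional (S.outcomeFunctional l) :=
  isPositiveFunctional_traceFunctional (S.R_pos l) S.posSemidef_jointState

theorem outcomeFunctional_localTensor (l : Fin N → Bool)
    (O : ∀ i, Matrix (Fin (S.dA i)) (Fin (S.dA i)) ℝ) :
    S.outcomeFunctional l (localTensorMap S.dA O) = S.jointExp l O := rfl

/-- The reduced state of the party `k`. -/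
noncomputable def marginal (k : Fin N) : Matrix (Fin (S.dA k)) (Fin (S.dA k)) ℝ →ₗ[ℝ] ℝ :=
  traceFunctional 1 (S.ρ k)

theorem isState_marginal (k : Fin N) : IsState (S.marginal k) where
  toIsPositiveFunctional :=
    isPositiveFunctional_traceFunctional Matrix.PosSemidef.one (S.ρ_pos k)
  map_one := by
    rw [marginal, traceFunctional_apply, Matrix.one_kronecker_one, one_mul, S.ρ_trace]

/-- Summed over Eve's outcomes, the state of the external parties is a product state. -/
theorem sum_outcomeFunctional_localTensor (O : ∀ i, Matrix (Fin (S.dA i)) (Fin (S.dA i)) ℝ) :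
    (∑ l, S.outcomeFunctional l) (localTensorMap S.dA O) = ∏ k, S.marginal k (O k) := by
  have h1 : (∑ l, S.outcomeFunctional l) (localTensorMap S.dA O) =
      ((localTensor O ⊗ₖ (1 : Matrix (∀ i, Fin (S.dE i)) (∀ i, Fin (S.dE i)) ℝ)) *
        S.jointState).trace := by
    rw [← S.R_sum, LinearMap.sum_apply]
    simp only [outcomeFunctional, traceFunctional_apply, localTensorMap_apply]
    rw [← Matrix.trace_sum, ← Finset.sum_mul]
    congr 2
    ext p q
    simp [Matrix.sum_apply, Matrix.kroneckerMap_apply, Finset.mul_sum]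
  rw [h1]
  simp only [marginal, traceFunctional_apply, Matrix.trace, Matrix.diag_apply, Matrix.mul_apply,
    Matrix.kroneckerMap_apply]
  rw [← sum_prod_pi fun i a b => ∑ y : Fin (S.dA i) × Fin (S.dE i),
    O i a y.1 * (1 : Matrix (Fin (S.dE i)) (Fin (S.dE i)) ℝ) b y.2 * S.ρ i y (a, b)]
  refine Finset.sum_congr rfl fun p _ => ?_
  rw [← sum_prod_pi fun i a b => O i (p.1 i) a *
    (1 : Matrix (Fin (S.dE i)) (Fin (S.dE i)) ℝ) (p.2 i) b * S.ρ i (a, b) (p.1 i, p.2 i)]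
  refine Finset.sum_congr rfl fun q _ => ?_
  have h2 : (1 : Matrix (∀ i, Fin (S.dE i)) (∀ i, Fin (S.dE i)) ℝ) p.2 q.2 =
      ∏ i, (1 : Matrix (Fin (S.dE i)) (Fin (S.dE i)) ℝ) (p.2 i) (q.2 i) := by
    have := (isStarTensor_localTensorMap S.dE).map_one
    rw [← this]; rfl
  rw [h2, localTensor, Matrix.of_apply, jointState, Matrix.of_apply, ← Finset.prod_mul_distrib,
    ← Finset.prod_mul_distrib]

theorem outcomeProb_eq (l : Fin N → Bool) : S.outcomeProb l = S.outcomeFunctional l 1 := by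
  rw [← (isStarTensor_localTensorMap S.dA).map_one]; rfl

/-- The normalised state of the external parties for Eve's outcome `l`. -/
noncomputable def condState (l : Fin N → Bool) :
    Matrix (∀ i, Fin (S.dA i)) (∀ i, Fin (S.dA i)) ℝ →ₗ[ℝ] ℝ :=
  (S.outcomeProb l)⁻¹ • S.outcomeFunctional l

theorem condState_localTensor (l : Fin N → Bool)
    (O : ∀ i, Matrix (Fin (S.dA i)) (Fin (S.dA i)) ℝ) :
    S.condState l (localTensorMap S.dA O) = S.condExp l O := by
  rw [condState, LinearMap.smul_apply, outcomeFunctional_localTensor, condExp, smul_eq_mul,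
    div_eq_inv_mul]

theorem outcomeProb_nonneg (l : Fin N → Bool) : 0 ≤ S.outcomeProb l := by
  rw [outcomeProb_eq]
  simpa using (S.isPositiveFunctional_outcomeFunctional l).nonneg 1

theorem isState_condState {l : Fin N → Bool} (hl : S.outcomeProb l ≠ 0) :
    IsState (S.condState l) where
  map_star x := by
    simp only [condState, LinearMap.smul_apply,
      (S.isPositiveFunctional_outcomeFunctional l).map_star]
  nonneg x := by
    rw [condState, LinearMap.smul_apply, smul_eq_mul]
    exact mul_nonneg (inv_nonneg.2 (S.outcomeProb_nonneg l))
      ((S.isPositiveFunctional_outcomeFunctional l).nonneg x)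
  map_one := by
    rw [condState, LinearMap.smul_apply, smul_eq_mul, ← outcomeProb_eq, inv_mul_cancel₀ hl]

theorem outcomeFunctional_eq {l : Fin N → Bool} (hl : S.outcomeProb l ≠ 0)
    (x : Matrix (∀ i, Fin (S.dA i)) (∀ i, Fin (S.dA i)) ℝ) :
    S.outcomeFunctional l x = S.outcomeProb l * S.condState l x := by
  rw [condState, LinearMap.smul_apply, smul_eq_mul, mul_inv_cancel_left₀ hl]

theorem sum_outcomeProb : ∑ l, S.outcomeProb l = 1 := by
  have := S.sum_outcomeFunctional_localTensor 1
  rw [(isStarTensor_localTensorMap S.dA).map_one, LinearMap.sum_apply] at this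
  simp only [← outcomeProb_eq] at this
  rw [this]
  exact Finset.prod_eq_one fun k _ => (S.isState_marginal k).map_one

/-- Ignoring Eve leaves party `k` in the mixture of its conditional states, so estimates uniform in
`l` pass to the marginal. -/
theorem marginal_eq_sum (h : ∀ l, S.outcomeProb l ≠ 0) (k : Fin N)
    (a : Matrix (Fin (S.dA k)) (Fin (S.dA k)) ℝ) :
    S.marginal k a = ∑ l, S.outcomeProb l *
      S.condState l ((isStarTensor_localTensorMap S.dA).emb k a) := by
  have h1 := S.sum_outcomeFunctional_localTensor (Pi.mulSingle k a)
  rw [LinearMap.sum_apply, Finset.prod_eq_single k, Pi.mulSingle_eq_same] at h1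
  · rw [← h1]
    exact Finset.sum_congr rfl fun l _ => S.outcomeFunctional_eq (h l) _
  · intro j _ hj
    rw [Pi.mulSingle_eq_of_ne hj, (S.isState_marginal j).map_one]
  · simp

end RealStarNetwork

/-! ### Invariance of Pauli moments under signs and mixtures -/

section SignsAndAverages

variable {A : Type*} [Ring A] [Algebra ℝ A] [StarRing A] [StarModule ℝ A]

/-- Every moment is either bounded in absolute value or even in both `X` and `Z`. -/
theorem IsApproxPauli.of_smul {φ : A →ₗ[ℝ] ℝ} {X Z : A} {η s t : ℝ} (hs : |s| = 1) (ht : |t| = 1)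
    (h : IsApproxPauli φ (s • X) (t • Z) η) : IsApproxPauli φ X Z η := by
  have hs' : s * s = 1 := by rw [← abs_mul_abs_self, hs, one_mul]
  have ht' : t * t = 1 := by rw [← abs_mul_abs_self, ht, one_mul]
  obtain ⟨h1, h2, h3, h4, h5, h6, h7⟩ := h
  simp only [smul_mul_assoc, mul_smul_comm, smul_smul, map_smul, smul_eq_mul, abs_mul, hs, ht, hs',
    ht', one_mul, mul_one, one_smul] at h1 h2 h3 h4 h5 h6 h7
  refine ⟨h1, h2, h3, h4, h5, h6, ?_⟩
  have : t * s * s * t = 1 := by linear_combination t * t * hs' + ht'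
  linear_combination h7 + φ (Z * X * X * Z) * this

/-- Approximate Pauli moments are inherited by mixtures. -/
theorem IsApproxPauli.average {B : Type*} [Ring B] [Algebra ℝ B] [StarRing B] [StarModule ℝ B]
    {Λ : Type*} [Fintype Λ] {f : B →⋆ₐ[ℝ] A} {φ : Λ → A →ₗ[ℝ] ℝ} {p : Λ → ℝ} (hp : ∀ l, 0 ≤ p l)
    (hp1 : ∑ l, p l = 1) {e : B →ₗ[ℝ] ℝ} (he : ∀ b, e b = ∑ l, p l * φ l (f b)) {X Z : B} {η : ℝ}
    (h : ∀ l, IsApproxPauli (φ l) (f X) (f Z) η) : IsApproxPauli e X Z η := by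
  have habs : ∀ {b : B} {c : ℝ}, (∀ l, |φ l (f b)| ≤ c) → |e b| ≤ c := by
    intro b c hb
    rw [he]
    refine (Finset.abs_sum_le_sum_abs _ _).trans ?_
    calc ∑ l, |p l * φ l (f b)| ≤ ∑ l, p l * c := by
          refine Finset.sum_le_sum fun l _ => ?_
          rw [abs_mul, abs_of_nonneg (hp l)]
          exact mul_le_mul_of_nonneg_left (hb l) (hp l)
      _ = c := by rw [← Finset.sum_mul, hp1, one_mul]
  have hsub : ∀ {b : B} {c : ℝ}, (∀ l, 1 - φ l (f b) ≤ c) → 1 - e b ≤ c := by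
    intro b c hb
    rw [he, ← hp1, ← Finset.sum_sub_distrib]
    calc ∑ l, (p l - p l * φ l (f b)) ≤ ∑ l, p l * c := by
          refine Finset.sum_le_sum fun l _ => ?_
          have := mul_le_mul_of_nonneg_left (hb l) (hp l)
          linarith
      _ = c := by rw [← Finset.sum_mul, hp1, one_mul]
  refine ⟨habs fun l => (h l).abs_Z, habs fun l => (h l).abs_X, habs fun l => ?_,
    habs fun l => ?_, hsub fun l => ?_, hsub fun l => ?_, hsub fun l => ?_⟩
  · simpa using (h l).abs_XZ
  · simpa using (h l).abs_ZXZ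
  · simpa using (h l).ZZ
  · simpa using (h l).XX
  · simpa using (h l).ZXXZ

theorem abs_bitSign (b : Bool) : |bitSign b| = 1 := by cases b <;> simp [bitSign]

theorem clip_bitSign_smul (b : Bool) (x : A) : clip (bitSign b • x) = bitSign b • clip x := by
  cases b <;> simp [bitSign, clip_neg]

theorem IsObservable.bitSign_smul {x : A} (hx : IsObservable x) (b : Bool) :
    IsObservable (bitSign b • x) := by
  cases b
  · simpa [bitSign] using hx
  · simpa [bitSign] using hx.neg

end SignsAndAverages

/-! ### The Bell and Mermin functionals in terms of the self-tested observables -/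

namespace RealStarNetwork

variable {N : ℕ} [NeZero N] (S : RealStarNetwork N)

/-- The first observables of the parties, with the sign that Eve's outcome `l` dictates. -/
noncomputable def signedObs0 (l : Fin N → Bool) (i : Fin N) :
    Matrix (Fin (S.dA i)) (Fin (S.dA i)) ℝ :=
  bitSign (l i) • S.obs i 0

/-- The second observables of the parties, with the sign that Eve's outcome `l` dictates. -/
noncomputable def signedObs1 (l : Fin N → Bool) (i : Fin N) :
    Matrix (Fin (S.dA i)) (Fin (S.dA i)) ℝ :=
  if i = 0 then bitSign (l i) • S.obs i 1 else S.obs i 1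

theorem isObservable_signedObs0 (l : Fin N → Bool) (i : Fin N) :
    IsObservable (S.signedObs0 l i) := (S.isObservable_obs i 0).bitSign_smul _

theorem isObservable_signedObs1 (l : Fin N → Bool) (i : Fin N) :
    IsObservable (S.signedObs1 l i) := by
  unfold signedObs1
  split_ifs
  exacts [(S.isObservable_obs i 1).bitSign_smul _, S.isObservable_obs i 1]

theorem signedObs0_false : S.signedObs0 (fun _ => false) = fun i => S.obs i 0 := by
  ext1 i; simp [signedObs0, bitSign]

theorem signedObs1_false : S.signedObs1 (fun _ => false) = fun i => S.obs i 1 := by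
  ext1 i; simp [signedObs1, bitSign]

/-- The `X`-type observables. -/
noncomputable def pauliX : ∀ i, Matrix (Fin (S.dA i)) (Fin (S.dA i)) ℝ :=
  xObs 0 (fun i => S.obs i 0) fun i => S.obs i 1

/-- The `Z`-type observables. -/
noncomputable def pauliZ : ∀ i, Matrix (Fin (S.dA i)) (Fin (S.dA i)) ℝ :=
  zObs 0 (fun i => S.obs i 0) fun i => S.obs i 1

theorem isObservable_pauliX (i : Fin N) : IsObservable (S.pauliX i) :=
  IsObservable.xObs (fun i => S.isObservable_obs i 0) (fun i => S.isObservable_obs i 1) i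

theorem isObservable_pauliZ (i : Fin N) : IsObservable (S.pauliZ i) :=
  IsObservable.zObs (fun i => S.isObservable_obs i 0) (fun i => S.isObservable_obs i 1) i

theorem xObs_signed (l : Fin N → Bool) (i : Fin N) :
    xObs 0 (S.signedObs0 l) (S.signedObs1 l) i =
      (if i = 0 then bitSign (l i) else 1) • S.pauliX i := by
  by_cases hi : i = 0
  · simp only [xObs, pauliX, hi, if_true, signedObs0, signedObs1]
    rw [← smul_add, smul_comm, clip_bitSign_smul]
  · simp [xObs, pauliX, hi, signedObs1]

theorem zObs_signed (l : Fin N → Bool) (i : Fin N) :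
    zObs 0 (S.signedObs0 l) (S.signedObs1 l) i = bitSign (l i) • S.pauliZ i := by
  by_cases hi : i = 0
  · simp only [zObs, pauliZ, hi, if_true, signedObs0, signedObs1]
    rw [← smul_sub, smul_comm, clip_bitSign_smul]
  · simp [zObs, pauliZ, hi, signedObs0]

theorem condExp_smul (l : Fin N → Bool) (O : ∀ i, Matrix (Fin (S.dA i)) (Fin (S.dA i)) ℝ)
    (k : Fin N) (c : ℝ) :
    S.condExp l (Function.update O k (c • O k)) = c * S.condExp l O := by
  rw [← condState_localTensor, MultilinearMap.map_update_smul, map_smul, smul_eq_mul,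
    Function.update_eq_self, condState_localTensor]

/-- The sign of `l 0` goes into both observables of the first party, and the sign of `l j` into
`A_{j,0}` only. All outcomes then obey one and the same sign-free Bell inequality. -/
theorem bellI_eq (l : Fin N → Bool) :
    S.bellI l = ((N : ℝ) - 1) * S.condState l (localTensorMap S.dA fun i =>
        if i = 0 then (√2)⁻¹ • (S.signedObs0 l i + S.signedObs1 l i) else S.signedObs1 l i) +
      ∑ j : Fin N with j ≠ 0, S.condState l (localTensorMap S.dA fun i =>
        if i = 0 then (√2)⁻¹ • (S.signedObs0 l i - S.signedObs1 l i) else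
          if i = j then S.signedObs0 l i else 1) := by
  have h1 : S.condState l (localTensorMap S.dA fun i =>
      if i = 0 then (√2)⁻¹ • (S.signedObs0 l i + S.signedObs1 l i) else S.signedObs1 l i) =
      bitSign (l 0) * S.condExp l (fun i => if i = 0 then S.tilde1 i else S.obs i 1) := by
    rw [← condExp_smul _ _ _ 0, condState_localTensor]
    congr 1
    ext1 i
    by_cases hi : i = 0
    · subst hi
      simp only [if_true, Function.update_self, tilde1, signedObs0, signedObs1]
      rw [← smul_add, smul_comm]
    · simp [hi, signedObs1]
  have h2 : ∀ j, j ≠ 0 → S.condState l (localTensorMap S.dA fun i =>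
        if i = 0 then (√2)⁻¹ • (S.signedObs0 l i - S.signedObs1 l i) else
          if i = j then S.signedObs0 l i else 1) =
      bitSign (l 0) * (bitSign (l j) * S.condExp l
        (fun i => if i = 0 then S.tilde0 i else if i = j then S.obs i 0 else 1)) := by
    intro j hj
    rw [← condExp_smul _ _ _ j, ← condExp_smul _ _ _ 0, condState_localTensor]
    congr 1
    ext1 i
    by_cases hi : i = 0
    · subst hi
      simp only [if_true, Function.update_self, Function.update_of_ne hj.symm, tilde0, signedObs0,
        signedObs1]
      rw [← smul_sub, smul_comm]
    · by_cases hij : i = j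
      · subst hij
        simp [hi, signedObs0]
      · simp [hi, hij]
  rw [h1, Finset.sum_congr rfl fun j hj => h2 j (by simpa using hj), bellI, ← Finset.mul_sum]
  ring

variable {S} {ε : ℝ}

theorem isNearGHZ_signed (hN : 2 ≤ N) (hε : 0 ≤ ε) (h : S.NearlyOptimal ε) {l : Fin N → Bool}
    (hl : S.outcomeProb l ≠ 0) :
    IsNearGHZ (isStarTensor_localTensorMap S.dA) (S.condState l) 0
        (xObs 0 (S.signedObs0 l) (S.signedObs1 l)) (zObs 0 (S.signedObs0 l) (S.signedObs1 l))
        √(2 * ε) ∧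
      gnsNorm (S.condState l)
        ((isStarTensor_localTensorMap S.dA).emb 0
            ((√2)⁻¹ • (S.signedObs0 l 0 + S.signedObs1 l 0)) -
          (isStarTensor_localTensorMap S.dA).emb 0
            (xObs 0 (S.signedObs0 l) (S.signedObs1 l) 0)) ≤ 3 * √(2 * ε) := by
  refine isNearGHZ_of_bell _ (S.isState_condState hl) (by simpa using hN)
    (S.isObservable_signedObs0 l) (S.isObservable_signedObs1 l) (Real.sqrt_nonneg _) ?_
  have := h.1 l
  rw [bellI_eq] at this
  rw [Real.sq_sqrt (by linarith), Fintype.card_fin]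
  convert this using 1
  ring

/-- The self-tested observables depend on `l` only through signs, to which the moment bounds are
blind; averaging over `l` then yields the marginal. -/
theorem isApproxPauli_marginal (hN : 2 ≤ N) (hε : 0 ≤ ε) (h : S.NearlyOptimal ε)
    (hl : ∀ l, S.outcomeProb l ≠ 0) (k : Fin N) :
    IsApproxPauli (S.marginal k) (S.pauliX k) (S.pauliZ k) √(2 * ε) := by
  refine IsApproxPauli.average (f := (isStarTensor_localTensorMap S.dA).emb k)
    S.outcomeProb_nonneg S.sum_outcomeProb (S.marginal_eq_sum hl k) fun l => ?_
  have := (isNearGHZ_signed hN hε h (hl l)).1.pauli k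
  rw [xObs_signed, zObs_signed, map_smul, map_smul] at this
  refine this.of_smul ?_ (abs_bitSign _)
  split_ifs
  exacts [abs_bitSign _, abs_one]

/-- The correlator of `J_N` with `Y`-type observables at `i, j` and `X`-type ones elsewhere. -/
noncomputable def correlator (S : RealStarNetwork N) (i j : Fin N) : ℝ :=
  S.condState (fun _ => false) (localTensorMap S.dA fun k =>
    if k = i ∨ k = j then S.obs k 2 else S.pauliX k)

theorem correlator_comm (i j : Fin N) : S.correlator i j = S.correlator j i := by
  simp only [correlator, or_comm]

theorem sum_offDiag_eq_two_mul (c : Fin N → Fin N → ℝ) (hc : ∀ i j, c i j = c j i) :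
    ∑ p ∈ Finset.univ.offDiag, c p.1 p.2 = 2 * ∑ i, ∑ j with i < j, c i j := by
  have h1 : ∑ p ∈ (Finset.univ : Finset (Fin N)).offDiag, c p.1 p.2 =
      ∑ i, ∑ j with i ≠ j, c i j := by
    rw [Finset.sum_sigma', Finset.sum_bij' (fun p _ => (⟨p.1, p.2⟩ : Σ _ : Fin N, Fin N))
      (fun p _ => (p.1, p.2))] <;> simp
  have h2 : ∀ i : Fin N, ∑ j with i ≠ j, c i j =
      ∑ j with i < j, c i j + ∑ j with j < i, c i j := by
    intro i
    rw [← Finset.sum_union]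
    · congr 1
      ext j
      simp [lt_or_lt_iff_ne]
    · rw [Finset.disjoint_filter]
      intro j _ h; exact h.not_gt
  have h3 : ∑ i, ∑ j with j < i, c i j = ∑ i, ∑ j with i < j, c i j := by
    rw [Finset.sum_comm' (t' := Finset.univ) (s' := fun j => Finset.univ.filter (j < ·)) (by simp)]
    exact Finset.sum_congr rfl fun i _ => Finset.sum_congr rfl fun j _ => hc _ _
  rw [h1, Finset.sum_congr rfl fun i _ => h2 i, Finset.sum_add_distrib, h3]
  ring

/-- `J_N` in terms of the correlators of the clipped observables. -/
theorem mul_merminJ_le (hN : 2 ≤ N) (hε : 0 ≤ ε) (h : S.NearlyOptimal ε)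
    (hl : S.outcomeProb (fun _ => false) ≠ 0) :
    (N : ℝ) * (N - 1) * S.merminJ ≤
      -∑ p ∈ Finset.univ.offDiag, S.correlator p.1 p.2 + 3 * ((N : ℝ) * (N - 1)) * √(2 * ε) := by
  have hst := S.isState_condState hl
  have hT := isStarTensor_localTensorMap S.dA
  obtain ⟨-, hx⟩ := isNearGHZ_signed hN hε h hl
  rw [signedObs0_false, signedObs1_false] at hx
  set η := √(2 * ε)
  have hη : 0 ≤ η := Real.sqrt_nonneg _
  have hN' : (2 : ℝ) ≤ N := by exact_mod_cast hN
  have first : ∀ j₁ j₂ : Fin N, j₁ ≠ 0 → j₂ ≠ 0 → S.correlator j₁ j₂ - 3 * η ≤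
      S.condExp (fun _ => false) (fun i =>
        if i = 0 then S.tilde1 i else if i = j₁ ∨ i = j₂ then S.obs i 2 else S.obs i 1) := by
    intro j₁ j₂ h1 h2
    set r : Matrix (∀ i, Fin (S.dA i)) (∀ i, Fin (S.dA i)) ℝ := localTensorMap S.dA fun k =>
      if k = 0 then 1 else if k = j₁ ∨ k = j₂ then S.obs k 2 else S.obs k 1 with hr
    have ro : IsObservable r := hT.isObservable fun k => by
      split_ifs
      exacts [.one, S.isObservable_obs k 2, S.isObservable_obs k 1]
    have e1 : S.condExp (fun _ => false) (fun i =>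
        if i = 0 then S.tilde1 i else if i = j₁ ∨ i = j₂ then S.obs i 2 else S.obs i 1) =
        S.condState (fun _ => false) (r * hT.emb 0 ((√2)⁻¹ • (S.obs 0 0 + S.obs 0 1))) := by
      rw [← condState_localTensor, hr, hT.emb_apply, ← hT.map_mul]
      congr 2
      ext1 i
      by_cases hi : i = 0
      · subst hi; simp [tilde1]
      · simp [hi]
    have e2 : S.correlator j₁ j₂ =
        S.condState (fun _ => false) (r * hT.emb 0 (S.pauliX 0)) := by
      rw [correlator, hr, hT.emb_apply, ← hT.map_mul]
      congr 2
      ext1 i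
      by_cases hi : i = 0
      · subst hi; simp [h1.symm, h2.symm]
      · simp [hi, pauliX, xObs]
    have h3 := (ro.abs_mul_le hst (hT.emb 0 ((√2)⁻¹ • (S.obs 0 0 + S.obs 0 1)) -
      hT.emb 0 (S.pauliX 0))).trans hx
    rw [mul_sub, map_sub, ← e1, ← e2] at h3
    linarith [(abs_le.1 h3).1]
  -- Here the first party measures its third observable, so nothing is clipped and no error arises.
  have second : ∀ j : Fin N, S.condExp (fun _ => false) (fun i =>
      if i = 0 ∨ i = j then S.obs i 2 else S.obs i 1) = S.correlator 0 j := by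
    intro j
    rw [correlator, ← condState_localTensor]
    congr 2
    ext1 i
    by_cases hi : i = 0
    · subst hi; simp
    · simp [hi, pauliX, xObs]
  have hpos : ∀ j : Fin N, 0 < j ↔ j ≠ 0 := fun j => Fin.pos_iff_ne_zero
  set J₁ := ∑ j₁ : Fin N with j₁ ≠ 0, ∑ j₂ : Fin N with j₁ < j₂,
        S.condExp (fun _ => false) (fun i =>
          if i = 0 then S.tilde1 i else if i = j₁ ∨ i = j₂ then S.obs i 2 else S.obs i 1) with hJ₁
  set J₂ := ∑ j : Fin N with j ≠ 0, S.condExp (fun _ => false) (fun i =>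
          if i = 0 ∨ i = j then S.obs i 2 else S.obs i 1) with hJ₂
  have hsum : ∑ i, ∑ j with i < j, (S.correlator i j - 3 * η) ≤ J₁ + J₂ := by
    rw [← Finset.sum_filter_add_sum_filter_not Finset.univ (fun i : Fin N => i ≠ 0)]
    refine add_le_add (Finset.sum_le_sum fun i hi => Finset.sum_le_sum fun j hj => ?_) ?_
    · have hi' : i ≠ 0 := by simpa using hi
      have hj' : i < j := by simpa using hj
      exact first i j hi' ((hpos j).1 (((hpos i).2 hi').trans hj'))
    · have : (Finset.univ.filter fun i : Fin N => ¬ i ≠ 0) = {0} := by ext; simp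
      rw [this, Finset.sum_singleton, hJ₂]
      simp only [hpos]
      refine Finset.sum_le_sum fun j _ => ?_
      rw [second]
      linarith
  have hoff := sum_offDiag_eq_two_mul S.correlator fun i j => correlator_comm i j
  have hoff' := sum_offDiag_eq_two_mul (fun _ _ : Fin N => 3 * η) fun _ _ => rfl
  rw [Finset.sum_const, Finset.offDiag_card, Finset.card_univ, Fintype.card_fin, nsmul_eq_mul,
    Nat.cast_sub (Nat.le_mul_self N)] at hoff'
  push_cast at hoff'
  simp only [Finset.sum_sub_distrib] at hsum
  have hJ : (N : ℝ) * (N - 1) * S.merminJ = -2 * (J₁ + J₂) := by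
    have h1 : (N : ℝ) ≠ 0 := by linarith
    have h2 : (N : ℝ) - 1 ≠ 0 := by linarith
    rw [merminJ, ← hJ₁, ← hJ₂]
    field_simp
  rw [hJ]
  linarith

/-- Trivial bound: there are `N(N-1)/2` correlators, each at most `1` in modulus after clipping. It
settles `N = 2` and every regime where the errors are large. -/
theorem merminJ_le_one_add (hN : 2 ≤ N) (hε : 0 ≤ ε) (h : S.NearlyOptimal ε) :
    S.merminJ ≤ 1 + 3 * √(2 * ε) := by
  have hη : 0 ≤ √(2 * ε) := Real.sqrt_nonneg _
  by_cases hl : S.outcomeProb (fun _ => false) = 0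
  -- Division by zero makes all conditional expectations vanish.
  · have : S.merminJ = 0 := by simp [merminJ, condExp, hl]
    linarith
  · have h1 := mul_merminJ_le hN hε h hl
    have h2 : -∑ p ∈ Finset.univ.offDiag, S.correlator p.1 p.2 ≤ (N : ℝ) * (N - 1) := by
      have : -∑ p ∈ Finset.univ.offDiag, S.correlator p.1 p.2 ≤
          ∑ p ∈ (Finset.univ : Finset (Fin N)).offDiag, (1 : ℝ) := by
        rw [← Finset.sum_neg_distrib]
        refine Finset.sum_le_sum fun p _ => ?_
        have := ((isStarTensor_localTensorMap S.dA).isContraction (O := fun k =>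
          if k = p.1 ∨ k = p.2 then S.obs k 2 else S.pauliX k) fun k => by
            split_ifs
            exacts [(S.isObservable_obs k 2).contr, (S.isObservable_pauliX k).contr])
        exact neg_le.1 (abs_le.1 (this.abs_apply_le_one (S.isState_condState hl))).1
      rw [Finset.sum_const, Finset.offDiag_card, Finset.card_univ, Fintype.card_fin, nsmul_eq_mul,
        Nat.cast_sub (Nat.le_mul_self N)] at this
      push_cast at this
      linarith
    have hN' : (2 : ℝ) ≤ N := by exact_mod_cast hN
    have h3 : (0 : ℝ) < (N : ℝ) * (N - 1) := mul_pos (by linarith) (by linarith)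
    refine le_of_mul_le_mul_left ?_ h3
    linarith

end RealStarNetwork

/-! ### Numerical estimates and conclusion -/

theorem three_le_fErr {N : ℕ} (hN : 2 ≤ N) : 3 ≤ fErr N := by
  have hN' : (2 : ℝ) ≤ N := by exact_mod_cast hN
  have h2 : √2 ≤ 3 / 2 := Real.sqrt_le_iff.2 ⟨by norm_num, by norm_num⟩
  have h2' := Real.sqrt_nonneg 2
  have h3 : √(1 / ((N : ℝ) - 1)) ≤ 1 :=
    Real.sqrt_le_iff.2 ⟨zero_le_one, by rw [one_pow, div_le_one (by linarith)]; linarith⟩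
  have h4 := Real.sqrt_nonneg (1 / ((N : ℝ) - 1))
  have h5 := Real.sqrt_nonneg (2 * ((N : ℝ) - 1))
  have hδ : 0 ≤ deltaErr N := by
    unfold deltaErr
    have h6 : (0 : ℝ) ≤ N - 1 := by linarith
    positivity
  unfold fErr
  have h7 : 0 ≤ (N : ℝ) ^ 2 / 2 * (deltaErr N + √(2 * ((N : ℝ) - 1))) ^ 2 := by positivity
  have h8 : -(√2 + 1 + √(1 / ((N : ℝ) - 1))) ≤
      ((N : ℝ) - 3) * (√2 + 1 + √(1 / ((N : ℝ) - 1))) := by nlinarith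
  linarith

/-- The quadratic term with `δ_N ≥ 20N` already gives this. The main argument needs no other feature
of `f`, only a quartic lower bound. -/
theorem le_fErr {N : ℕ} (hN : 3 ≤ N) : 200 * (N : ℝ) ^ 4 ≤ fErr N := by
  have hN' : (3 : ℝ) ≤ N := by exact_mod_cast hN
  have h2 : 7 / 5 ≤ √2 := Real.le_sqrt_of_sq_le (by norm_num)
  have h4 := Real.sqrt_nonneg (1 / ((N : ℝ) - 1))
  have h5 := Real.sqrt_nonneg (2 * ((N : ℝ) - 1))
  have hδ : 20 * (N : ℝ) ≤ deltaErr N := by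
    unfold deltaErr
    have h6 : 2 * (N : ℝ) * (N - 1) * (12 / 5) ≤
        2 * (N : ℝ) * (N - 1) * (√2 + 1 + √(1 / ((N : ℝ) - 1))) :=
      mul_le_mul_of_nonneg_left (by linarith)
        (mul_nonneg (by linarith) (by linarith))
    nlinarith
  have h7 : (20 * (N : ℝ)) ^ 2 ≤ (deltaErr N + √(2 * ((N : ℝ) - 1))) ^ 2 :=
    pow_le_pow_left₀ (by linarith) (by linarith) 2
  have h8 : (N : ℝ) ^ 2 / 2 * (20 * (N : ℝ)) ^ 2 ≤
      (N : ℝ) ^ 2 / 2 * (deltaErr N + √(2 * ((N : ℝ) - 1))) ^ 2 :=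
    mul_le_mul_of_nonneg_left h7 (by positivity)
  have h9 : 0 ≤ ((N : ℝ) - 3) * (√2 + 1 + √(1 / ((N : ℝ) - 1))) :=
    mul_nonneg (by linarith) (by linarith)
  unfold fErr
  nlinarith

/-- The final optimisation over the weight `p` of Eve's outcome. -/
theorem value_le_of_weighted_bound {n J g p q η f : ℝ} (hn : 3 ≤ n) (hη : 0 ≤ η)
    (hf : 200 * n ^ 4 ≤ f) (hq : 0 ≤ q) (hp : 1 - q ≤ p)
    (hJg : n * (n - 1) * J ≤ g + 26 * n ^ 2 * η)
    (hg : p * (g - 33 * n ^ 3 * η) ≤ n + 754 * n ^ 2 * η) (hJ : J ≤ 1 + 3 * η) :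
    J ≤ 1 / (n - 1) + f * η + q := by
  have hn1 : 0 < n - 1 := by linarith
  have hfη : 200 * n ^ 4 * η ≤ f * η := mul_le_mul_of_nonneg_right hf hη
  have hn4 : 81 ≤ n ^ 4 := by
    have := pow_le_pow_left₀ (by norm_num) hn 4
    norm_num at this; exact this
  have h3η : 3 * η ≤ f * η := by nlinarith
  -- If `1 - q` is below `1/(n-1)`, then `1/(n-1) + q` exceeds `1` and the trivial bound suffices.
  -- Otherwise `(1-q)(n-1) ≥ 1`, which gives `1/(1-q) ≤ 1 + (n-1)q` and turns division by the weight
  -- into the additive error `q`.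
  by_cases hx : 1 - q < 1 / (n - 1)
  · linarith
  · push Not at hx
    have hx' : 1 ≤ (1 - q) * (n - 1) := by
      rwa [div_le_iff₀ hn1] at hx
    have hx0 : 0 < 1 - q := lt_of_lt_of_le (by positivity) hx
    have hg' : g - 33 * n ^ 3 * η ≤ n + n * (n - 1) * q + 754 * n ^ 2 * (n - 1) * η := by
      by_cases h0 : g - 33 * n ^ 3 * η ≤ 0
      · have : 0 ≤ n + n * (n - 1) * q + 754 * n ^ 2 * (n - 1) * η := by positivity
        linarith
      · push Not at h0
        have h1 : (1 - q) * (g - 33 * n ^ 3 * η) ≤ n + 754 * n ^ 2 * η :=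
          (mul_le_mul_of_nonneg_right hp h0.le).trans hg
        refine le_of_mul_le_mul_left (h1.trans ?_) hx0
        have h2 : 754 * n ^ 2 * η * 1 ≤ 754 * n ^ 2 * η * ((1 - q) * (n - 1)) :=
          mul_le_mul_of_nonneg_left hx' (by positivity)
        have h3 : n * q * 1 ≤ n * q * ((1 - q) * (n - 1)) :=
          mul_le_mul_of_nonneg_left hx' (by positivity)
        linarith
    have hnn : 0 < n * (n - 1) := by positivity
    refine le_of_mul_le_mul_left ?_ hnn
    have e : n * (n - 1) * (1 / (n - 1) + f * η + q) =
        n + n * (n - 1) * q + n * (n - 1) * (f * η) := by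
      field_simp
      ring
    rw [e]
    have h4 : 754 * n ^ 2 * (n - 1) * η + 33 * n ^ 3 * η + 26 * n ^ 2 * η ≤ 813 * n ^ 3 * η := by
      have h5 : n ^ 2 * η ≤ n ^ 3 * η :=
        mul_le_mul_of_nonneg_right (pow_le_pow_right₀ (by linarith) (by norm_num)) hη
      nlinarith [mul_nonneg (sq_nonneg n) hη]
    have h6 : 813 * n ^ 3 * η ≤ n * (n - 1) * (200 * n ^ 4 * η) := by
      have h7 : 813 * n ^ 3 ≤ n * (n - 1) * (200 * n ^ 4) := by
        have h8 : 9 ≤ n ^ 2 := by nlinarith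
        have h9 : 18 ≤ n ^ 2 * (n - 1) := by nlinarith
        have : n * (n - 1) * (200 * n ^ 4) = n ^ 3 * (200 * (n ^ 2 * (n - 1))) := by ring
        rw [this]
        have : 0 ≤ n ^ 3 := by positivity
        nlinarith
      have := mul_le_mul_of_nonneg_right h7 hη
      linarith
    have h8 := mul_le_mul_of_nonneg_left hfη hnn.le
    linarith

namespace RealStarNetwork

theorem merminJ_le {N : ℕ} [NeZero N] (hN : 2 ≤ N) {S : RealStarNetwork N} {ε : ℝ}
    (h : S.NearlyOptimal ε) :
    S.merminJ ≤ 1 / ((N : ℝ) - 1) + fErr N * √(2 * ε) + 2 ^ N * ε := by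
  have hε : 0 ≤ ε := (abs_nonneg _).trans (h.2 fun _ => false)
  have hη : 0 ≤ √(2 * ε) := Real.sqrt_nonneg _
  have hη2 : √(2 * ε) ^ 2 = 2 * ε := Real.sq_sqrt (by linarith)
  have hJ := merminJ_le_one_add hN hε h
  have hq : 0 ≤ 2 ^ N * ε := by positivity
  have hf3 := three_le_fErr hN
  rcases hN.eq_or_lt with rfl | hN3
  · have e : (1 : ℝ) / (((2 : ℕ) : ℝ) - 1) = 1 := by norm_num
    rw [e]
    nlinarith
  have hN3 : 3 ≤ N := hN3
  have hN' : (3 : ℝ) ≤ N := by exact_mod_cast hN3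
  have hf := le_fErr hN3
  set η := √(2 * ε) with hηdef
  -- If `fη ≥ 2`, one half of `fη` covers the `1` and the other half the `3η` of the trivial bound.
  -- Otherwise `η` is small enough for the self-test argument.
  by_cases hbig : 2 ≤ fErr N * η
  · have h1 : 0 ≤ 1 / ((N : ℝ) - 1) := div_nonneg zero_le_one (by linarith)
    have h2 : 81 ≤ (N : ℝ) ^ 4 := by
      have := pow_le_pow_left₀ (by norm_num) hN' 4
      norm_num at this; exact this
    have h3 : 6 * η ≤ fErr N * η := mul_le_mul_of_nonneg_right (by linarith) hη
    linarith
  · push Not at hbig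
    have hN4 : 27 * (N : ℝ) ≤ (N : ℝ) ^ 4 := by
      have h3 : (3 : ℝ) ^ 3 ≤ (N : ℝ) ^ 3 := pow_le_pow_left₀ (by norm_num) hN' 3
      have : (N : ℝ) ^ 4 = N ^ 3 * N := by ring
      rw [this]
      nlinarith
    have hsmall' : 5400 * (N : ℝ) * η ≤ fErr N * η :=
      mul_le_mul_of_nonneg_right (by linarith) hη
    have hsmall : 54 * (Fintype.card (Fin N) : ℝ) * η ≤ 1 := by
      rw [Fintype.card_fin]; nlinarith
    have hη1 : η ≤ 1 := by nlinarith
    -- An outcome of probability zero would have Bell value `0` by the division convention,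
    -- contradicting near-optimality for small `ε`.
    have hprob : ∀ l, S.outcomeProb l ≠ 0 := by
      intro l hl
      have h1 := h.1 l
      have h2 : S.bellI l = 0 := by simp [bellI, condExp, hl]
      rw [h2] at h1
      nlinarith
    have hnear := (isNearGHZ_signed hN hε h (hprob fun _ => false)).1
    rw [signedObs0_false, signedObs1_false] at hnear
    obtain ⟨g, hg1, hg2⟩ := mermin_bound (isStarTensor_localTensorMap S.dA) S.isObservable_pauliX
      (fun k => S.isObservable_obs k 2) S.isObservable_pauliZ
      S.sum_outcomeFunctional_localTensor S.isState_marginal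
      (isApproxPauli_marginal hN hε h hprob) (S.isState_condState (hprob fun _ => false)) hnear
      (S.outcomeProb_nonneg fun _ => false) (fun y => by
        -- The domination `P φ ≤ ρ`: the outcome `0…0` is one of the nonnegative summands of `ρ`.
        rw [← S.outcomeFunctional_eq (hprob _), LinearMap.sum_apply]
        exact Finset.single_le_sum (f := fun l => S.outcomeFunctional l (star y * y))
          (fun l _ => (S.isPositiveFunctional_outcomeFunctional l).nonneg y) (Finset.mem_univ _))
      (by simpa using hN3) hsmall
    rw [Fintype.card_fin] at hg1 hg2
    have hmul := mul_merminJ_le hN hε h (hprob fun _ => false)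
    have hp : 1 - 2 ^ N * ε ≤ 2 ^ N * S.outcomeProb fun _ => false := by
      have h1 := (abs_le.1 (h.2 fun _ => false)).1
      have h2 := mul_le_mul_of_nonneg_left h1 (by positivity : (0 : ℝ) ≤ 2 ^ N)
      have h3 : (2 : ℝ) ^ N * (1 / 2 ^ N) = 1 := by field_simp
      rw [mul_sub, h3] at h2
      linarith
    have hlin : (N : ℝ) * (N - 1) * S.merminJ ≤ g + 26 * (N : ℝ) ^ 2 * η := by
      have : 0 ≤ (N : ℝ) * η := by positivity
      have e : ∑ p ∈ Finset.univ.offDiag, S.correlator p.1 p.2 = ∑ p ∈ Finset.univ.offDiag,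
          S.condState (fun _ => false) (localTensorMap S.dA fun k =>
            if k = p.1 ∨ k = p.2 then S.obs k 2 else S.pauliX k) := rfl
      rw [e] at hmul
      linarith
    exact value_le_of_weighted_bound hN' hη hf hq hp hlin hg2 hJ

end RealStarNetwork

theorem theorem2 :
    (∀ (N : ℕ) [NeZero N], 2 ≤ N → ∀ ε : ℝ, ∀ J ∈ rqtValues N ε,
      J ≤ 1 / ((N : ℝ) - 1) + fErr N * √(2 * ε) + 2 ^ N * ε) ∧
    (∀ K : ℝ, ∃ C : ℝ, ∀ (N : ℕ) [NeZero N], 2 ≤ N → ∀ ε : ℝ,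
      fErr N ^ 2 / 4 ^ N ≤ K * ε → ∀ J ∈ rqtValues N ε,
        J ≤ 1 / ((N : ℝ) - 1) + C * (2 ^ N * ε)) := by
  -- In this regime `f ≤ √(|K|ε) 2^N`, so `f √(2ε) ≤ √(2|K|) 2^N ε`; the added `1` accounts for the
  -- term `2^N ε`.
  refine ⟨?_, fun K => ⟨√(2 * |K|) + 1, ?_⟩⟩
  · rintro N _ hN ε J ⟨S, hS, rfl⟩
    exact RealStarNetwork.merminJ_le hN hS
  · rintro N _ hN ε hK J ⟨S, hS, rfl⟩
    have hε : 0 ≤ ε := (abs_nonneg _).trans (hS.2 fun _ => false)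
    have h1 := RealStarNetwork.merminJ_le hN hS
    have h2 : fErr N * √(2 * ε) ≤ √(2 * |K|) * (2 ^ N * ε) := by
      apply le_of_sq_le_sq _ (by positivity)
      rw [mul_pow, mul_pow, Real.sq_sqrt (by positivity), Real.sq_sqrt (by positivity)]
      rw [div_le_iff₀ (by positivity)] at hK
      have h3 : K * ε * 4 ^ N ≤ |K| * ε * 4 ^ N := by
        gcongr
        exact le_abs_self K
      have h4 : (4 : ℝ) ^ N = (2 ^ N) ^ 2 := by rw [← pow_mul, mul_comm, pow_mul]; norm_num
      calc fErr N ^ 2 * (2 * ε) ≤ |K| * ε * 4 ^ N * (2 * ε) :=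
            mul_le_mul_of_nonneg_right (hK.trans h3) (by linarith)
        _ = 2 * |K| * (2 ^ N * ε) ^ 2 := by rw [h4]; ring
    linarith
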